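/- Fix an integer $b\ge 0$ (the cache size; for $b\ge1$ this is the usual situation). Adaptive sampling reads a stream of keys in which exactly $n$ distinct keys occur (in any order and with any multiplicities). The hashed values $h(x)$ of the distinct keys $x$ are independent infinite sequences of independent unbiased bits. The algorithm keeps a bucket $B$ of keys and a depth $d$, initially $B=\emptyset$, $d=0$. When a key $x$ is read and $h(x)$ starts with $0^d$, then $x$ is put into $B$ (unless it is already there); as long as $|B|>b$, the depth $d$ is increased by $1$ and the keys of $B$ whose hashed values do not start with $0^d$ are removed. Let $D$ be the final depth, $R$ the final size of $B$, $\lg=\log_2$, $W=\lg(R2^D/n)=D-\lg n+\lg R$ (for $R>0$), $p(r,\cdot)=\mathbb P(R=r)$, and $\mathbb E(Y;A)=\mathbb E(Y\mathbf 1_A)$. Put $L=\ln 2$, $\chi_l=2l\pi \mathbf i/L$ and, for $0\le r\le b$, \[ f(r,\eta)=e^{-2^{-\eta}}\frac{2^{-r\eta}}{r!}\Bigl[1-e^{-2^{-\eta}}\sum_{k=0}^{b-r}\frac{2^{-k\eta}}{k!}\Bigr],\qquad \phi(r,\alpha)=\int_{-\infty}^{\infty}e^{\alpha\eta}f(r,\eta)\,d\eta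 , \] \[ \tilde m_{k,r}=\phi^{(k)}(r,0),\qquad \tilde w_{k,r}=\tilde w_{k,r}(n)=\sum_{l\ne0}\phi^{(k)}(r,\alpha)\big|_{\alpha=-L\chi_l}\,e^{-2l\pi\mathbf i\lg n}, \] where $\phi^{(k)}$ is the $k$-th derivative with respect to $\alpha$. Let $\psi=\Gamma'/\Gamma$ be the digamma function and $\gamma$ Euler's constant. Then all the moments below are finite and all the Fourier series converge absolutely. Moreover, there is a $\delta>0$ such that the following holds, where $X_n\sim Y_n$ means $X_n-Y_n=O(n^{-\delta})$ as $n\to\infty$, and the streams are arbitrary. 1. For all $k\ge0$ and $0\le r\le b$: $\mathbb E[(D-\lg n)^k;R=r]\sim\tilde m_{k,r}+\tilde w_{k,r}$. 2. \[ \mathbb E(W;R>0)\sim\sum_{r=1}^b\tilde m_{1,r}+\sum_{r=1}^b p(r,\cdot)\lg r+\sum_{r=1}^b\tilde w_{1,r}, \] \[ \mathbb E(W^2;R>0)\sim\sum_{r=1}^b\tilde m_{2,r}+2\sum_{r=1}^b\tilde m_{1,r}\lg r+\sum_{r=1}^b p(r,\cdot)(\lg r)^2+\sum_{r=1}^b\tilde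 w_{2,r}+2\sum_{r=1}^b\tilde w_{1,r}\lg r . \] Finally, for $k=1$ one has explicitly, for $1\le r\le b$, \[ \tilde m_{1,r}=-\frac{\psi(r)}{L^2r}+\sum_{k=0}^{b-r}\frac{(\psi(r+k)-L)2^{-(r+k)}\Gamma(r+k)}{L^2\Gamma(r+1)\Gamma(k+1)}, \] \[ \tilde w_{1,r}=\sum_{l\ne0}\Bigl[-\frac{\psi(r+\chi_l)\Gamma(r+\chi_l)}{L^2\Gamma(r+1)}+\sum_{k=0}^{b-r}\frac{(\psi(r+k+\chi_l)-L)2^{-(r+k)}\Gamma(r+k+\chi_l)}{L^2\Gamma(r+1)\Gamma(k+1)}\Bigr]e^{-2l\pi\mathbf i\lg n}, \] and for $r=0$ \[ \tilde m_{1,0}=\frac12+\frac{\gamma}{L}+\sum_{k=1}^{b}\frac{(\psi(k)-L)2^{-k}}{kL^2}, \] \[ \tilde w_{1,0}=\sum_{l\ne0}\Bigl[-\frac{\psi(\chi_l)\Gamma(\chi_l)}{L^2}+\sum_{k=0}^{b}\frac{\Gamma(k+\chi_l)}{L^2k!2^k}(\psi(k+\chi_l)-L)\Bigr]e^{-2l\pi\mathbf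 i\lg n}. \] -/

import Mathlib

open MeasureTheory Asymptotics Filter

noncomputable section

namespace AdaptiveSampling

/-! ### The algorithm -/

/-- The hashed value of the key `x` starts with `0^d` (the bit `0` is `false`). -/
abbrev Matches {n : ℕ} (h : Fin n → ℕ → Bool) (d : ℕ) (x : Fin n) : Prop :=
  ∀ i < d, h x i = false

/-- One step of adaptive sampling with a cache of size `b`, in the state `(B, d)` (bucket and depth),
on reading the key `x`.  If the hashed value of `x` starts with `0^d`, then `x` is put into the bucket
(nothing happens if it is there already).  Then, as long as the bucket holds more than `b` keys, the
depth is increased by one and the bucket is filtered: the depth becomes the least `d' ≥ d` for which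
the filtered bucket holds at most `b` keys.  (The set of such `d'` is empty only if more than `b`
keys have the hashed value `000…`, an event of probability zero.) -/
def step {n : ℕ} (b : ℕ) (h : Fin n → ℕ → Bool) (s : Finset (Fin n) × ℕ) (x : Fin n) :
    Finset (Fin n) × ℕ :=
  let B : Finset (Fin n) := if Matches h s.2 x then insert x s.1 else s.1
  let d : ℕ := sInf {d' : ℕ | s.2 ≤ d' ∧ (B.filter (Matches h d')).card ≤ b}
  (B.filter (Matches h d), d)

/-- Final state (bucket and depth) after the whole stream `S` of keys has been read. -/
def run {n : ℕ} (b : ℕ) (S : List (Fin n)) (h : Fin n → ℕ → Bool) : Finset (Fin n) × ℕ :=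
  S.foldl (step b h) (∅, 0)

/-- Final depth `D`. -/
def depth {n : ℕ} (b : ℕ) (S : List (Fin n)) (h : Fin n → ℕ → Bool) : ℕ := (run b S h).2

/-- Final cache size `R`. -/
def size {n : ℕ} (b : ℕ) (S : List (Fin n)) (h : Fin n → ℕ → Bool) : ℕ := (run b S h).1.card

/-- The hashed values of the `n` distinct keys are independent infinite sequences of independent
unbiased bits. -/
def hashMeasure (n : ℕ) : Measure (Fin n → ℕ → Bool) :=
  Measure.pi fun _ : Fin n => Measure.infinitePi fun _ : ℕ => (PMF.uniformOfFintype Bool).toMeasure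

/-- The binary logarithm. -/
def lg (x : ℝ) : ℝ := Real.logb 2 x

/-- `W = lg Z` with `Z = R 2^D / n`. -/
def W {n : ℕ} (b : ℕ) (S : List (Fin n)) (h : Fin n → ℕ → Bool) : ℝ :=
  lg ((size b S h : ℝ) * 2 ^ depth b S h / (n : ℝ))

/-- `E[(D - lg n)^k; R = r]`. -/
def momentD {n : ℕ} (b : ℕ) (S : List (Fin n)) (k r : ℕ) : ℝ :=
  ∫ h in {h | size b S h = r}, ((depth b S h : ℝ) - lg n) ^ k ∂(hashMeasure n)

/-- `E(W^k; R > 0)`. -/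
def momentW {n : ℕ} (b : ℕ) (S : List (Fin n)) (k : ℕ) : ℝ :=
  ∫ h in {h | 0 < size b S h}, W b S h ^ k ∂(hashMeasure n)

/-- `p(r, .) = P(R = r)`. -/
def probR {n : ℕ} (b : ℕ) (S : List (Fin n)) (r : ℕ) : ℝ :=
  (hashMeasure n).real {h | size b S h = r}

/-! ### The limiting objects -/

/-- `f(r, η)`; used for `r ≤ b` only. -/
def f (b r : ℕ) (η : ℝ) : ℝ :=
  Real.exp (-(2 : ℝ) ^ (-η)) * ((2 : ℝ) ^ (-(r * η)) / (r.factorial : ℝ)) *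
    (1 - Real.exp (-(2 : ℝ) ^ (-η)) *
      ∑ k ∈ Finset.range (b - r + 1), (2 : ℝ) ^ (-(k * η)) / (k.factorial : ℝ))

/-- The Laplace transform `φ(r, α) = ∫ e^{α η} f(r, η) dη`. -/
def phi (b r : ℕ) (α : ℂ) : ℂ := ∫ η : ℝ, Complex.exp (α * η) * (f b r η : ℂ)

/-- `L = ln 2`, as a complex number. -/
def L : ℂ := (Real.log 2 : ℝ)

/-- `χ_l = 2 l π i / L`. -/
def chi (l : ℤ) : ℂ := 2 * l * Real.pi * Complex.I / L

/-- The factor `e^{-2 l π i lg n}`. -/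
def wave (l : ℤ) (n : ℕ) : ℂ := Complex.exp (-(2 * l * Real.pi * Complex.I * (lg n : ℝ)))

/-- `m̃_{k,r} = φ^{(k)}(r, 0)`, the derivatives being taken in the second variable. -/
def mTilde (b k r : ℕ) : ℂ := iteratedDeriv k (phi b r) 0

/-- The term of index `l` of the Fourier series `w̃_{k,r}`, that is
`φ^{(k)}(r, -L χ_l) e^{-2 l π i lg n}`. -/
def wTerm (b k r n : ℕ) (l : ℤ) : ℂ := iteratedDeriv k (phi b r) (-(L * chi l)) * wave l n

/-- `w̃_{k,r}`, a Fourier series in `lg n`. -/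
def wTilde (b k r n : ℕ) : ℂ := ∑' l : {l : ℤ // l ≠ 0}, wTerm b k r n l

end AdaptiveSampling

end

/-! Almost surely no key survives from some depth on, and then the final state forgets the order and
multiplicity of the stream. `D` is the least depth `d` at which at most `b` of the `n` keys start
with `0^d`, and `R` counts those keys (`run_eq_of_mem`). Hence `D = d + 1, R = r` means that `r`
keys survive at depth `d + 1` and more than `b` at depth `d`. Independence gives the exact
probability as a combination of binomial terms in `q = 2^{-(d+1)}` (`hashMeasure_real_joint`).

Put `u = n q = 2^{-η}`, where `η` is the depth minus `lg n`. Each binomial term is close to `u^j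
e^{-cu}` with `c = 1` or `2`, and the combination is close to `f(r, η)`. The error is at most `K/n *
2^{-|η|}`, uniformly in `η` (`exists_abs_jointProbInt_sub_f_le`). Summed against `η^k` over all
integer depths, this error stays `O(1/n)`, so `δ = 1` works and the moment becomes `∑_d (d - lg n)^k
f(r, d - lg n)`.

Differentiating in `η` maps combinations of the functions `u^j e^{-cu}` to such combinations, so
`η^k f(r, η)` is a Schwartz function. Poisson summation (`ExpDecay.poisson`) turns the sum into an
absolutely convergent Fourier series in `lg n`. Its coefficients are `φ^{(k)}(r, -Lχ_l)`
(`wTerm_eq`); the index `0` gives `m̃` and the others give `w̃`. The moments of `W` follow by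
expanding `W = (D - lg n) + lg R`.

For the explicit formulas, the transform of `u^j e^{-cu}` with `j ≥ 1` is a Gamma integral
(`laplace_kernel`). When `r = 0` the terms `e^{-u}` and `e^{-2u}` have no transform separately at
the points needed; their difference is handled by integration by parts (`laplace_expDiff_mul`). -/

noncomputable section

namespace AdaptiveSampling

/-! ### The final state of the algorithm -/

/-- The keys whose hashed value starts with `0^d`. -/
def zeros {n : ℕ} (h : Fin n → ℕ → Bool) (d : ℕ) : Finset (Fin n) :=
  Finset.univ.filter (Matches h d)

/-- The least depth at which at most `b` keys survive. -/
def leastDepth {n : ℕ} (b : ℕ) (h : Fin n → ℕ → Bool) : ℕ :=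
  sInf {d | (zeros h d).card ≤ b}

/-- At some depth no key survives. -/
def Good {n : ℕ} (h : Fin n → ℕ → Bool) : Prop := ∃ d, ∀ x, ¬ Matches h d x

lemma Matches.mono {n : ℕ} {h : Fin n → ℕ → Bool} {d e : ℕ} (hde : d ≤ e) {x : Fin n}
    (hx : Matches h e x) : Matches h d x := fun i hi => hx i (hi.trans_le hde)

lemma zeros_anti {n : ℕ} (h : Fin n → ℕ → Bool) {d e : ℕ} (hde : d ≤ e) :
    zeros h e ⊆ zeros h d := by
  intro x hx
  simp only [zeros, Finset.mem_filter, Finset.mem_univ, true_and] at hx ⊢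
  exact Matches.mono hde hx

lemma card_zeros_anti {n : ℕ} (h : Fin n → ℕ → Bool) {d e : ℕ} (hde : d ≤ e) :
    (zeros h e).card ≤ (zeros h d).card := Finset.card_le_card (zeros_anti h hde)

lemma zeros_zero {n : ℕ} (h : Fin n → ℕ → Bool) : zeros h 0 = Finset.univ := by
  simp [zeros, Matches]

/-- The loop invariant, with `T` the set of keys read so far. A larger `T` has a larger least depth,
so keys already discarded at depth `D` would not survive at the new depth either. -/
lemma step_eq {n : ℕ} (b : ℕ) (h : Fin n → ℕ → Bool) (hg : Good h) (T : Finset (Fin n))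
    (x : Fin n) :
    step b h (T.filter (Matches h (sInf {d | (T.filter (Matches h d)).card ≤ b})),
        sInf {d | (T.filter (Matches h d)).card ≤ b}) x =
      ((insert x T).filter
          (Matches h (sInf {d | ((insert x T).filter (Matches h d)).card ≤ b})),
        sInf {d | ((insert x T).filter (Matches h d)).card ≤ b}) := by
  set D := sInf {d | (T.filter (Matches h d)).card ≤ b} with hD
  have hB : (if Matches h D x then insert x (T.filter (Matches h D)) else T.filter (Matches h D)) =
      (insert x T).filter (Matches h D) := by
    rw [Finset.filter_insert]
  have hF : ∀ d', D ≤ d' → ((insert x T).filter (Matches h D)).filter (Matches h d') =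
      (insert x T).filter (Matches h d') := by
    intro d' hd'
    rw [Finset.filter_filter]
    refine Finset.filter_congr fun y _ => ⟨fun hy => hy.2, fun hy => ⟨Matches.mono hd' hy, hy⟩⟩
  have hmem : ∀ d', ((insert x T).filter (Matches h d')).card ≤ b → D ≤ d' := by
    intro d' hd'
    refine Nat.sInf_le ?_
    exact (Finset.card_le_card (Finset.filter_subset_filter _ (Finset.subset_insert x T))).trans hd'
  have hset : {d' : ℕ | D ≤ d' ∧
      (((insert x T).filter (Matches h D)).filter (Matches h d')).card ≤ b} =
      {d | ((insert x T).filter (Matches h d)).card ≤ b} := by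
    ext d'
    simp only [Set.mem_ofPred_eq]
    constructor
    · rintro ⟨h1, h2⟩
      rwa [hF d' h1] at h2
    · intro h2
      exact ⟨hmem d' h2, by rwa [hF d' (hmem d' h2)]⟩
  -- Without `Good` this set could be empty and its `sInf` would be the default `0`, possibly below
  -- `D`.
  have hne : {d | ((insert x T).filter (Matches h d)).card ≤ b}.Nonempty := by
    obtain ⟨d, hd⟩ := hg
    refine ⟨d, ?_⟩
    simp only [Set.mem_ofPred_eq]
    rw [Finset.filter_false_of_mem (fun y _ => hd y)]
    simp
  have hle : D ≤ sInf {d | ((insert x T).filter (Matches h d)).card ≤ b} :=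
    hmem _ (Nat.sInf_mem hne)
  simp only [step]
  rw [hB, hset, hF _ hle]

lemma run_eq {n : ℕ} (b : ℕ) (h : Fin n → ℕ → Bool) (hg : Good h) (S : List (Fin n)) :
    run b S h = (S.toFinset.filter
        (Matches h (sInf {d | (S.toFinset.filter (Matches h d)).card ≤ b})),
      sInf {d | (S.toFinset.filter (Matches h d)).card ≤ b}) := by
  induction S using List.reverseRecOn with
  | nil => simp [run]
  | append_singleton l x ih =>
    have hl : (l ++ [x]).toFinset = insert x l.toFinset := by
      ext y; simp
    rw [hl, ← step_eq b h hg, ← ih]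
    simp [run]

lemma run_eq_of_mem {n : ℕ} (b : ℕ) (h : Fin n → ℕ → Bool) (hg : Good h) (S : List (Fin n))
    (hS : ∀ x, x ∈ S) : run b S h = (zeros h (leastDepth b h), leastDepth b h) := by
  have : S.toFinset = Finset.univ := by ext x; simp [hS]
  rw [run_eq b h hg, this]
  rfl

lemma depth_eq {n : ℕ} (b : ℕ) (h : Fin n → ℕ → Bool) (hg : Good h) (S : List (Fin n))
    (hS : ∀ x, x ∈ S) : depth b S h = leastDepth b h := by
  rw [depth, run_eq_of_mem b h hg S hS]

lemma size_eq {n : ℕ} (b : ℕ) (h : Fin n → ℕ → Bool) (hg : Good h) (S : List (Fin n))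
    (hS : ∀ x, x ∈ S) : size b S h = (zeros h (leastDepth b h)).card := by
  rw [size, run_eq_of_mem b h hg S hS]

lemma Good.card_zeros_le {n : ℕ} {b : ℕ} {h : Fin n → ℕ → Bool} (hg : Good h) :
    (zeros h (leastDepth b h)).card ≤ b := by
  obtain ⟨d, hd⟩ := hg
  refine Nat.sInf_mem (s := {d | (zeros h d).card ≤ b}) ⟨d, ?_⟩
  simp only [Set.mem_ofPred_eq]
  rw [zeros, Finset.filter_false_of_mem (fun y _ => hd y)]
  simp

lemma leastDepth_succ_le {n : ℕ} {b : ℕ} {h : Fin n → ℕ → Bool} {d : ℕ}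
    (hd : d < leastDepth b h) : b < (zeros h d).card := by
  by_contra hlt
  have : leastDepth b h ≤ d := Nat.sInf_le (not_lt.mp hlt)
  omega

lemma leastDepth_eq_succ_iff {n : ℕ} {b : ℕ} {h : Fin n → ℕ → Bool} (d : ℕ) :
    leastDepth b h = d + 1 ↔ (zeros h (d + 1)).card ≤ b ∧ b < (zeros h d).card := by
  constructor
  · intro hd
    refine ⟨?_, ?_⟩
    · rw [← hd]
      -- Since `sInf ∅ = 0`, a successor value already forces the set to be nonempty; this is why
      -- `Good` is not assumed.
      exact Nat.sInf_mem (Nat.nonempty_of_sInf_eq_succ hd)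
    · exact leastDepth_succ_le (by omega)
  · rintro ⟨h1, h2⟩
    refine le_antisymm (Nat.sInf_le h1) ?_
    by_contra hlt
    have h3 := card_zeros_anti h (show leastDepth b h ≤ d by omega)
    have h4 : (zeros h (leastDepth b h)).card ≤ b :=
      Nat.sInf_mem (s := {d | (zeros h d).card ≤ b}) ⟨d + 1, h1⟩
    omega

/-- The final depth is `d + 1` and the final size `r` iff `r` keys survive at depth `d + 1` and more
than `b` at depth `d`. -/
lemma leastDepth_and_card_iff {n : ℕ} {b r : ℕ} (hr : r ≤ b) {h : Fin n → ℕ → Bool}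
    (d : ℕ) :
    (leastDepth b h = d + 1 ∧ (zeros h (leastDepth b h)).card = r) ↔
      ((zeros h (d + 1)).card = r ∧ b < (zeros h d).card) := by
  constructor
  · rintro ⟨h1, h2⟩
    exact ⟨h1 ▸ h2, ((leastDepth_eq_succ_iff d).1 h1).2⟩
  · rintro ⟨h1, h2⟩
    have := (leastDepth_eq_succ_iff (b := b) d).2 ⟨h1 ▸ hr, h2⟩
    exact ⟨this, this ▸ h1⟩

lemma leastDepth_ne_zero {n : ℕ} {b : ℕ} (hb : b < n) {h : Fin n → ℕ → Bool} (hg : Good h) :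
    leastDepth b h ≠ 0 := by
  intro h0
  have := hg.card_zeros_le (b := b)
  rw [h0, zeros_zero] at this
  simp at this
  omega

/-! ### The joint law of the numbers of surviving keys at two consecutive depths -/

/-- The law of the hashed value of one key. -/
def bitMeasure : Measure (ℕ → Bool) :=
  Measure.infinitePi fun _ : ℕ => (PMF.uniformOfFintype Bool).toMeasure

instance : IsProbabilityMeasure bitMeasure := by unfold bitMeasure; infer_instance

instance (n : ℕ) : IsProbabilityMeasure (hashMeasure n) := by unfold hashMeasure; infer_instance

/-- The bit sequences that start with `0^d`. -/
def zeroPrefix (d : ℕ) : Set (ℕ → Bool) := {ω | ∀ i < d, ω i = false}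

lemma zeroPrefix_eq_pi (d : ℕ) :
    zeroPrefix d = Set.pi (Finset.range d : Set ℕ) fun _ => {false} := by
  ext ω; simp [zeroPrefix]

lemma measurableSet_zeroPrefix (d : ℕ) : MeasurableSet (zeroPrefix d) := by
  rw [zeroPrefix_eq_pi]
  exact MeasurableSet.pi (Finset.range d).countable_toSet fun _ _ => measurableSet_singleton _

lemma zeroPrefix_anti {d e : ℕ} (hde : d ≤ e) : zeroPrefix e ⊆ zeroPrefix d :=
  fun _ hω i hi => hω i (hi.trans_le hde)

lemma bitMeasure_real_zeroPrefix (d : ℕ) : bitMeasure.real (zeroPrefix d) = (2 : ℝ)⁻¹ ^ d := by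
  rw [zeroPrefix_eq_pi, measureReal_def, bitMeasure,
    Measure.infinitePi_pi _ (fun _ _ => measurableSet_singleton _)]
  simp

lemma mem_zeros {n : ℕ} {h : Fin n → ℕ → Bool} {d : ℕ} {x : Fin n} :
    x ∈ zeros h d ↔ h x ∈ zeroPrefix d := by
  simp [zeros, zeroPrefix, Matches]

lemma hashMeasure_real_pi {n : ℕ} (s : Fin n → Set (ℕ → Bool)) :
    (hashMeasure n).real (Set.pi Set.univ s) = ∏ x, bitMeasure.real (s x) := by
  rw [measureReal_def, hashMeasure, Measure.pi_pi, ENNReal.toReal_prod]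
  rfl

/-- The event that exactly the keys of `A` survive at depth `e`, exactly those of `C` at depth `d`. -/
lemma setOf_zeros_eq_pi {n d e : ℕ} (hde : d ≤ e) {A C : Finset (Fin n)} (hAC : A ⊆ C) :
    {h : Fin n → ℕ → Bool | zeros h e = A ∧ zeros h d = C} =
      Set.pi Set.univ fun x => if x ∈ A then zeroPrefix e else
        if x ∈ C then zeroPrefix d \ zeroPrefix e else (zeroPrefix d)ᶜ := by
  ext h
  simp only [Set.mem_ofPred_eq, Set.mem_pi, Set.mem_univ, true_imp_iff, Finset.ext_iff, mem_zeros]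
  rw [← forall_and]
  refine forall_congr' fun x => ?_
  have h1 := @zeroPrefix_anti d e hde (h x)
  have h2 := @hAC x
  by_cases hA : x ∈ A <;> by_cases hC : x ∈ C <;> simp [hA, hC] <;> tauto

lemma measurableSet_zeros_eq {n d e : ℕ} (hde : d ≤ e) {A C : Finset (Fin n)} (hAC : A ⊆ C) :
    MeasurableSet {h : Fin n → ℕ → Bool | zeros h e = A ∧ zeros h d = C} := by
  rw [setOf_zeros_eq_pi hde hAC]
  refine MeasurableSet.univ_pi fun x => ?_
  have h1 := measurableSet_zeroPrefix d
  have h2 := measurableSet_zeroPrefix e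
  split_ifs
  exacts [h2, h1.diff h2, h1.compl]

lemma hashMeasure_real_zeros_eq {n d e : ℕ} (hde : d ≤ e) {A C : Finset (Fin n)} (hAC : A ⊆ C) :
    (hashMeasure n).real {h | zeros h e = A ∧ zeros h d = C} =
      ((2 : ℝ)⁻¹ ^ e) ^ A.card * ((2 : ℝ)⁻¹ ^ d - (2 : ℝ)⁻¹ ^ e) ^ (C.card - A.card) *
        (1 - (2 : ℝ)⁻¹ ^ d) ^ (n - C.card) := by
  rw [setOf_zeros_eq_pi hde hAC, hashMeasure_real_pi]
  have hreal : ∀ x : Fin n, bitMeasure.real (if x ∈ A then zeroPrefix e else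
        if x ∈ C then zeroPrefix d \ zeroPrefix e else (zeroPrefix d)ᶜ) =
      if x ∈ A then (2 : ℝ)⁻¹ ^ e else if x ∈ C then ((2 : ℝ)⁻¹ ^ d - (2 : ℝ)⁻¹ ^ e) else
        (1 - (2 : ℝ)⁻¹ ^ d) := by
    intro x
    split_ifs
    · exact bitMeasure_real_zeroPrefix e
    · rw [measureReal_sdiff (zeroPrefix_anti hde) (measurableSet_zeroPrefix e),
        bitMeasure_real_zeroPrefix, bitMeasure_real_zeroPrefix]
    · rw [probReal_compl_eq_one_sub (measurableSet_zeroPrefix d), bitMeasure_real_zeroPrefix]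
  simp_rw [hreal]
  rw [Finset.prod_ite, Finset.prod_ite]
  simp only [Finset.prod_const]
  have c1 : (Finset.univ.filter fun x => x ∈ A) = A := by ext; simp
  have c2 : ((Finset.univ.filter fun x => x ∉ A).filter fun x => x ∈ C) = C \ A := by
    ext; simp [and_comm]
  have c3 : ((Finset.univ.filter fun x => x ∉ A).filter fun x => x ∉ C) = Cᶜ := by
    ext x
    simp only [Finset.mem_filter, Finset.mem_univ, true_and, Finset.mem_compl]
    exact ⟨fun h => h.2, fun h => ⟨fun hA => h (hAC hA), h⟩⟩
  rw [c1, c2, c3, Finset.card_sdiff_of_subset hAC, Finset.card_compl, Fintype.card_fin]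
  ring

/-- Exact law of the pair of survivor counts at the depths `d ≤ e`. -/
lemma hashMeasure_real_card_eq {n d e : ℕ} (hde : d ≤ e) (r k : ℕ) :
    MeasurableSet {h : Fin n → ℕ → Bool | (zeros h e).card = r ∧ (zeros h d).card = r + k} ∧
    (hashMeasure n).real {h | (zeros h e).card = r ∧ (zeros h d).card = r + k} =
      (n.choose (r + k) * (r + k).choose r : ℕ) *
        (((2 : ℝ)⁻¹ ^ e) ^ r * ((2 : ℝ)⁻¹ ^ d - (2 : ℝ)⁻¹ ^ e) ^ k *
          (1 - (2 : ℝ)⁻¹ ^ d) ^ (n - (r + k))) := by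
  -- Pairs `(C, A)` of survivor sets at the depths `d` and `e`, with `A ⊆ C`; all of them have the
  -- same probability.
  set P : Finset (Σ _ : Finset (Fin n), Finset (Fin n)) :=
    (Finset.powersetCard (r + k) (Finset.univ : Finset (Fin n))).sigma
      fun C => Finset.powersetCard r C with hP
  have hmem : ∀ p, p ∈ P ↔ p.1.card = r + k ∧ p.2 ⊆ p.1 ∧ p.2.card = r := by
    intro p
    simp [hP, Finset.mem_powersetCard]
  have hset : {h : Fin n → ℕ → Bool | (zeros h e).card = r ∧ (zeros h d).card = r + k} =
      ⋃ p ∈ P, {h | zeros h e = p.2 ∧ zeros h d = p.1} := by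
    ext h
    simp only [Set.mem_ofPred_eq, Set.mem_iUnion, exists_prop]
    constructor
    · rintro ⟨h1, h2⟩
      exact ⟨⟨zeros h d, zeros h e⟩, (hmem _).2 ⟨h2, zeros_anti h hde, h1⟩, rfl, rfl⟩
    · rintro ⟨p, hp, h1, h2⟩
      obtain ⟨p1, -, p3⟩ := (hmem p).1 hp
      exact ⟨h1 ▸ p3, h2 ▸ p1⟩
  have hms : ∀ p ∈ P, MeasurableSet {h : Fin n → ℕ → Bool | zeros h e = p.2 ∧ zeros h d = p.1} :=
    fun p hp => measurableSet_zeros_eq hde ((hmem p).1 hp).2.1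
  constructor
  · rw [hset]
    exact P.measurableSet_biUnion hms
  rw [hset, measureReal_biUnion_finset _ hms]
  · rw [Finset.sum_congr rfl (g := fun _ => ((2 : ℝ)⁻¹ ^ e) ^ r *
      ((2 : ℝ)⁻¹ ^ d - (2 : ℝ)⁻¹ ^ e) ^ k * (1 - (2 : ℝ)⁻¹ ^ d) ^ (n - (r + k)))]
    · rw [Finset.sum_const, nsmul_eq_mul]
      congr 2
      rw [hP, Finset.card_sigma]
      rw [Finset.sum_congr rfl (g := fun _ => (r + k).choose r)]
      · simp
      · intro C hC
        rw [Finset.card_powersetCard, (Finset.mem_powersetCard.1 hC).2]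
    · intro p hp
      obtain ⟨p1, p2, p3⟩ := (hmem p).1 hp
      rw [hashMeasure_real_zeros_eq hde p2, p1, p3]
      simp
  · intro p _ p' _ hpp
    refine Set.disjoint_left.2 fun h h1 h2 => hpp ?_
    obtain ⟨a, c⟩ := p
    obtain ⟨a', c'⟩ := p'
    simp only [Set.mem_ofPred_eq] at h1 h2
    rw [← h1.1, ← h1.2, ← h2.1, ← h2.2]

/-- The binomial counterpart of `u ^ j * exp (-(c * u))`, where `u = n * q`. -/
def binomTerm (n j : ℕ) (c q : ℝ) : ℝ := n.descFactorial j * q ^ j * (1 - c * q) ^ (n - j)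

/-- `P(R = r, D = d)` in terms of `q = 2^{-d}`, for `d ≥ 1`. -/
def jointProb (n b r : ℕ) (q : ℝ) : ℝ :=
  (binomTerm n r 1 q - ∑ k ∈ Finset.range (b - r + 1), binomTerm n (r + k) 2 q / k.factorial) /
    r.factorial

lemma choose_mul_choose_cast (n r k : ℕ) :
    ((n.choose (r + k) * (r + k).choose r : ℕ) : ℝ) =
      n.descFactorial (r + k) / k.factorial / r.factorial := by
  have h1 := Nat.descFactorial_eq_factorial_mul_choose n (r + k)
  have h2 := Nat.add_choose_mul_factorial_mul_factorial r k
  have hr : (r.factorial : ℝ) ≠ 0 := by positivity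
  have hk : (k.factorial : ℝ) ≠ 0 := by positivity
  rw [h1, ← h2, Nat.choose_symm_add]
  push_cast
  field_simp

/-- From the event of `r` survivors at depth `d + 1`, remove the disjoint events with `r + k ≤ b`
survivors at depth `d`. -/
lemma hashMeasure_real_joint {n b r : ℕ} (hr : r ≤ b) (d : ℕ) :
    MeasurableSet {h : Fin n → ℕ → Bool | (zeros h (d + 1)).card = r ∧ b < (zeros h d).card} ∧
    (hashMeasure n).real {h | (zeros h (d + 1)).card = r ∧ b < (zeros h d).card} =
      jointProb n b r ((2 : ℝ)⁻¹ ^ (d + 1)) := by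
  -- Equal depths and `k = 0` give the law of a single survivor count.
  have h0 := hashMeasure_real_card_eq (n := n) (le_refl (d + 1)) r 0
  simp only [add_zero, and_self, pow_zero, mul_one, Nat.choose_self] at h0
  have hk := fun k => hashMeasure_real_card_eq (n := n) (Nat.le_succ d) r k
  have hset : {h : Fin n → ℕ → Bool | (zeros h (d + 1)).card = r ∧ b < (zeros h d).card} =
      {h | (zeros h (d + 1)).card = r} \ ⋃ k ∈ Finset.range (b - r + 1),
        {h | (zeros h (d + 1)).card = r ∧ (zeros h d).card = r + k} := by
    ext h
    simp only [Set.mem_ofPred_eq, Set.mem_sdiff, Set.mem_iUnion, Finset.mem_range, exists_prop,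
      not_exists, not_and]
    have : (zeros h (d + 1)).card ≤ (zeros h d).card := card_zeros_anti h (Nat.le_succ d)
    constructor
    · rintro ⟨h1, h2⟩
      refine ⟨h1, fun k hk _ => by omega⟩
    · rintro ⟨h1, h2⟩
      refine ⟨h1, ?_⟩
      by_contra hb
      exact h2 ((zeros h d).card - r) (by omega) h1 (by omega)
  have hmU : MeasurableSet (⋃ k ∈ Finset.range (b - r + 1),
      {h : Fin n → ℕ → Bool | (zeros h (d + 1)).card = r ∧ (zeros h d).card = r + k}) :=
    Finset.measurableSet_biUnion _ fun k _ => (hk k).1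
  refine ⟨hset ▸ h0.1.diff hmU, ?_⟩
  rw [hset, measureReal_sdiff _ hmU, h0.2, measureReal_biUnion_finset _ fun k _ => (hk k).1]
  · rw [jointProb, sub_div, Finset.sum_div]
    congr 1
    · have := choose_mul_choose_cast n r 0
      simp only [add_zero, Nat.choose_self, mul_one, Nat.factorial_zero, Nat.cast_one,
        div_one] at this
      rw [this, binomTerm, one_mul]
      ring
    · refine Finset.sum_congr rfl fun k _ => ?_
      rw [(hk k).2, choose_mul_choose_cast, binomTerm]
      -- With `q = 2^{-(d+1)}`, the factor `2^{-d} - 2^{-(d+1)}` is again `q`, so the powers merge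
      -- into `q^{r+k}`, while `1 - 2^{-d} = 1 - 2q` accounts for `c = 2`.
      have e1 : (2 : ℝ)⁻¹ ^ d = 2 * (2 : ℝ)⁻¹ ^ (d + 1) := by rw [pow_succ]; ring
      simp only [Nat.succ_eq_add_one]
      rw [e1]
      ring
  · intro k _ k' _ hkk
    refine Set.disjoint_left.2 fun h h1 h2 => hkk ?_
    have a1 := h1.2
    have a2 := h2.2
    omega
  · intro h hh
    simp only [Set.mem_iUnion, exists_prop] at hh
    obtain ⟨k, -, hk⟩ := hh
    exact hk.1

/-- Union bound over the keys. It yields both `ae_good` and the geometric tail of the depth that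
makes all moments finite. -/
lemma hashMeasure_real_exists_matches_le (n d : ℕ) :
    (hashMeasure n).real {h | ∃ x, Matches h d x} ≤ n * (2 : ℝ)⁻¹ ^ d := by
  have hset : {h : Fin n → ℕ → Bool | ∃ x, Matches h d x} =
      ⋃ x ∈ (Finset.univ : Finset (Fin n)), {h | h x ∈ zeroPrefix d} := by
    ext h; simp [zeroPrefix, Matches]
  rw [hset]
  refine (measureReal_biUnion_finset_le _ _).trans ?_
  have : ∀ x : Fin n, (hashMeasure n).real {h | h x ∈ zeroPrefix d} = (2 : ℝ)⁻¹ ^ d := by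
    intro x
    have hp : MeasurePreserving (Function.eval x) (hashMeasure n) bitMeasure :=
      measurePreserving_eval _ x
    rw [← bitMeasure_real_zeroPrefix]
    exact hp.measureReal_preimage (measurableSet_zeroPrefix d).nullMeasurableSet
  simp [this]

lemma ae_good (n : ℕ) : ∀ᵐ h ∂(hashMeasure n), Good h := by
  rw [ae_iff]
  have hle : ∀ d : ℕ, (hashMeasure n).real {h | ¬ Good h} ≤ n * (2 : ℝ)⁻¹ ^ d := by
    intro d
    refine le_trans (measureReal_mono ?_) (hashMeasure_real_exists_matches_le n d)
    intro h hh
    simp only [Set.mem_ofPred_eq, Good, not_exists, not_forall, not_not] at hh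
    exact hh d
  have hlim : Tendsto (fun d : ℕ => (n : ℝ) * (2 : ℝ)⁻¹ ^ d) atTop (nhds (n * 0)) :=
    (tendsto_pow_atTop_nhds_zero_of_lt_one (by norm_num) (by norm_num)).const_mul _
  have h0 : (hashMeasure n).real {h | ¬ Good h} ≤ 0 := by
    simpa using ge_of_tendsto' hlim hle
  exact (measureReal_eq_zero_iff).1 (le_antisymm h0 measureReal_nonneg)

/-! ### Moments as sums over the depth -/

lemma measurable_card_zeros {n : ℕ} (d : ℕ) :
    Measurable fun h : Fin n → ℕ → Bool => (zeros h d).card := by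
  refine measurable_to_countable' fun j => ?_
  have := (hashMeasure_real_card_eq (n := n) (le_refl d) j 0).1
  simp only [add_zero, and_self] at this
  exact this

lemma measurable_leastDepth {n : ℕ} (b : ℕ) :
    Measurable fun h : Fin n → ℕ → Bool => leastDepth b h := by
  have hsucc : ∀ d : ℕ, MeasurableSet {h : Fin n → ℕ → Bool | leastDepth b h = d + 1} := by
    intro d
    simp only [leastDepth_eq_succ_iff]
    exact (measurable_card_zeros (d + 1) measurableSet_Iic).inter
      (measurable_card_zeros d measurableSet_Ioi)
  refine measurable_to_countable' fun j => ?_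
  cases j with
  | succ d => exact hsucc d
  | zero =>
    have : (fun h : Fin n → ℕ → Bool => leastDepth b h) ⁻¹' {0} =
        (⋃ d : ℕ, {h : Fin n → ℕ → Bool | leastDepth b h = d + 1})ᶜ := by
      ext h
      simp only [Set.mem_preimage, Set.mem_singleton_iff, Set.mem_compl_iff, Set.mem_iUnion,
        Set.mem_ofPred_eq, not_exists]
      constructor
      · intro h0 d; omega
      · intro hd
        by_contra h0
        exact hd (leastDepth b h - 1) (by omega)
    rw [this]
    exact (MeasurableSet.iUnion hsucc).compl

lemma measurable_card_zeros_leastDepth {n : ℕ} (b : ℕ) :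
    Measurable fun h : Fin n → ℕ → Bool => (zeros h (leastDepth b h)).card := by
  have h1 : Measurable fun p : (Fin n → ℕ → Bool) × ℕ => (zeros p.1 p.2).card :=
    measurable_from_prod_countable_left fun d => measurable_card_zeros d
  exact h1.comp (measurable_id.prodMk (measurable_leastDepth b))

/-- Measurability and integrability are established for `leastDepth` and its survivor count, then
transferred to `depth` and `size` by almost everywhere equality. -/
lemma depth_ae_eq {n : ℕ} (b : ℕ) (S : List (Fin n)) (hS : ∀ x, x ∈ S) :
    depth b S =ᵐ[hashMeasure n] leastDepth b := by
  filter_upwards [ae_good n] with h hg using depth_eq b h hg S hS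

lemma size_ae_eq {n : ℕ} (b : ℕ) (S : List (Fin n)) (hS : ∀ x, x ∈ S) :
    size b S =ᵐ[hashMeasure n] fun h => (zeros h (leastDepth b h)).card := by
  filter_upwards [ae_good n] with h hg using size_eq b h hg S hS

lemma summable_pow_mul_geometric (C : ℝ) (k : ℕ) :
    Summable fun d : ℕ => ((d : ℝ) + C) ^ k * (2 : ℝ)⁻¹ ^ d := by
  have h : ∀ j : ℕ, Summable fun d : ℕ => (d : ℝ) ^ j * (2 : ℝ)⁻¹ ^ d := fun j =>
    summable_pow_mul_geometric_of_norm_lt_one j (by norm_num)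
  simp_rw [add_pow, Finset.sum_mul]
  refine summable_sum fun j _ => ?_
  refine ((h j).mul_left (C ^ (k - j) * (k.choose j))).congr fun d => ?_
  ring

/-- Depth `d + 1` requires a key that matches at depth `d`, so it has probability at most `n
2^{-d}`; on the image measure on `ℕ` the integral is a convergent series. -/
lemma integrable_leastDepth_pow {n : ℕ} (b : ℕ) {C : ℝ} (hC : 0 ≤ C) (k : ℕ) :
    Integrable (fun h => ((leastDepth b h : ℝ) + C) ^ k) (hashMeasure n) := by
  have hm := (measurable_leastDepth (n := n) b)
  set m := (hashMeasure n).map (fun h => leastDepth b h) with hmdef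
  have : IsProbabilityMeasure m := Measure.isProbabilityMeasure_map hm.aemeasurable
  have key : Integrable (fun d : ℕ => ((d : ℝ) + C) ^ k) m := by
    rw [← Measure.sum_smul_dirac m]
    refine integrable_sum_dirac (fun d => measure_ne_top _ _) ?_
    rw [← summable_nat_add_iff 1]
    refine Summable.of_nonneg_of_le (fun d => by positivity) (fun d => ?_)
      ((summable_pow_mul_geometric (C + 1) k).mul_left (n : ℝ))
    have h1 : (m {d + 1}).toReal ≤ n * (2 : ℝ)⁻¹ ^ d := by
      rw [hmdef, Measure.map_apply hm (measurableSet_singleton _)]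
      refine le_trans (measureReal_mono (μ := hashMeasure n) ?_)
        (hashMeasure_real_exists_matches_le n d)
      intro h hh
      simp only [Set.mem_preimage, Set.mem_singleton_iff] at hh
      have h2 := leastDepth_succ_le (b := b) (h := h) (d := d) (by omega)
      obtain ⟨x, hx⟩ := Finset.card_pos.1 (show 0 < (zeros h d).card by omega)
      exact ⟨x, by simpa [zeros] using hx⟩
    rw [Real.norm_of_nonneg (by positivity)]
    push_cast
    rw [show (d : ℝ) + 1 + C = d + (C + 1) by ring]
    calc (m {d + 1}).toReal * (↑d + (C + 1)) ^ k
        ≤ (n * (2 : ℝ)⁻¹ ^ d) * (↑d + (C + 1)) ^ k := by gcongr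
      _ = _ := by ring
  exact (integrable_map_measure key.aestronglyMeasurable hm.aemeasurable).1 key

lemma integrable_depth_sub_pow {n : ℕ} (b : ℕ) (S : List (Fin n)) (hS : ∀ x, x ∈ S) (x : ℝ)
    (k : ℕ) : Integrable (fun h => ((depth b S h : ℝ) - x) ^ k) (hashMeasure n) := by
  have h1 : Integrable (fun h => ((leastDepth b h : ℝ) - x) ^ k) (hashMeasure n) := by
    refine (integrable_leastDepth_pow b (abs_nonneg x) k).mono' ?_ (ae_of_all _ fun h => ?_)
    · refine Measurable.aestronglyMeasurable ?_
      exact ((measurable_from_top.comp (measurable_leastDepth b)).sub_const x).pow_const k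
    · rw [norm_pow]
      gcongr
      refine (norm_sub_le _ _).trans ?_
      simp
  refine h1.congr ?_
  filter_upwards [depth_ae_eq b S hS] with h hh
  rw [hh]

lemma size_set_ae_eq {n : ℕ} (b : ℕ) (S : List (Fin n)) (hS : ∀ x, x ∈ S) (P : ℕ → Prop) :
    {h | P (size b S h)} =ᵐ[hashMeasure n] {h | P (zeros h (leastDepth b h)).card} := by
  filter_upwards [size_ae_eq b S hS] with h hh
  change P (size b S h) = P _
  rw [hh]

lemma measurableSet_card_leastDepth {n : ℕ} (b : ℕ) (P : ℕ → Prop) :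
    MeasurableSet {h : Fin n → ℕ → Bool | P (zeros h (leastDepth b h)).card} :=
  measurable_card_zeros_leastDepth b (MeasurableSet.of_discrete (s := {r | P r}))

lemma W_eq {n b : ℕ} {S : List (Fin n)} (hn : 1 ≤ n) {h : Fin n → ℕ → Bool}
    (hpos : 0 < size b S h) : W b S h = depth b S h - lg n + lg (size b S h) := by
  have h1 : (0 : ℝ) < size b S h := by exact_mod_cast hpos
  have h2 : (0 : ℝ) < n := by exact_mod_cast hn
  rw [W, lg, Real.logb_div (by positivity) h2.ne', Real.logb_mul h1.ne' (by positivity),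
    Real.logb_pow, Real.logb_self_eq_one (by norm_num)]
  simp only [lg]
  ring

lemma aestronglyMeasurable_W_pow {n : ℕ} (b : ℕ) (S : List (Fin n)) (hS : ∀ x, x ∈ S) (k : ℕ) :
    AEStronglyMeasurable (fun h => W b S h ^ k) (hashMeasure n) := by
  have hp : Measurable fun h : Fin n → ℕ → Bool =>
      ((zeros h (leastDepth b h)).card, leastDepth b h) :=
    (measurable_card_zeros_leastDepth b).prodMk (measurable_leastDepth b)
  set g : ℕ × ℕ → ℝ := fun p => lg ((p.1 : ℝ) * 2 ^ p.2 / (n : ℝ)) ^ k with hg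
  have hf : Measurable g := measurable_of_countable _
  refine (hf.comp hp).aestronglyMeasurable.congr ?_
  filter_upwards [depth_ae_eq b S hS, size_ae_eq b S hS] with h hd hs
  simp only [Function.comp_apply, hg, W, hd, hs]

lemma integrableOn_W_pow {n : ℕ} (b : ℕ) (hn : 1 ≤ n) (S : List (Fin n)) (hS : ∀ x, x ∈ S)
    (k : ℕ) : IntegrableOn (fun h => W b S h ^ k) {h | 0 < size b S h} (hashMeasure n) := by
  have hlg : 0 ≤ lg n := Real.logb_nonneg (by norm_num) (by exact_mod_cast hn)
  rw [integrableOn_congr_set_ae (size_set_ae_eq b S hS fun r => 0 < r)]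
  -- Majorant: `0 ≤ lg R ≤ lg n` gives `|D - lg n + lg R| ≤ D + 2 lg n`.
  have h1 : Integrable (fun h => ((leastDepth b h : ℝ) + 2 * lg n) ^ k) (hashMeasure n) :=
    integrable_leastDepth_pow b (by positivity) k
  refine h1.integrableOn.mono' ?_ ?_
  · exact (aestronglyMeasurable_W_pow b S hS k).restrict
  · rw [ae_restrict_iff' (measurableSet_card_leastDepth b fun r => 0 < r)]
    filter_upwards [depth_ae_eq b S hS, size_ae_eq b S hS] with h hd hs hpos
    have hpos' : 0 < size b S h := by rw [hs]; exact hpos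
    have hle : size b S h ≤ n := (Finset.card_le_univ (run b S h).1).trans (by simp)
    have h3 : lg (size b S h) ≤ lg n :=
      Real.logb_le_logb_of_le (by norm_num) (by exact_mod_cast hpos') (by exact_mod_cast hle)
    have h4 : 0 ≤ lg (size b S h) := Real.logb_nonneg (by norm_num) (by exact_mod_cast hpos')
    rw [norm_pow, W_eq hn hpos', hd]
    gcongr
    rw [Real.norm_eq_abs, abs_le]
    have h5 : (0 : ℝ) ≤ leastDepth b h := by positivity
    constructor <;> linarith

/-- For `b < n` depth `0` is impossible almost surely, so the events `D = d + 1, R = r` partition `R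
= r`, and on each of them the integrand is constant. -/
lemma hasSum_momentD {n b r : ℕ} (hb : b < n) (hr : r ≤ b) (S : List (Fin n))
    (hS : ∀ x, x ∈ S) (k : ℕ) :
    HasSum (fun d : ℕ => jointProb n b r ((2 : ℝ)⁻¹ ^ (d + 1)) * (((d + 1 : ℕ) : ℝ) - lg n) ^ k)
      (momentD b S k r) := by
  set s : ℕ → Set (Fin n → ℕ → Bool) :=
    fun d => {h | (zeros h (d + 1)).card = r ∧ b < (zeros h d).card} with hs
  have hmeas : ∀ d, MeasurableSet (s d) := fun d => (hashMeasure_real_joint hr d).1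
  have hdepth : ∀ d, ∀ h ∈ s d, leastDepth b h = d + 1 := by
    rintro d h ⟨h1, h2⟩
    exact (leastDepth_eq_succ_iff d).2 ⟨h1 ▸ hr, h2⟩
  have hunion : {h | size b S h = r} =ᵐ[hashMeasure n] ⋃ d, s d := by
    filter_upwards [ae_good n] with h hg
    refine propext ?_
    change size b S h = r ↔ h ∈ ⋃ d, s d
    rw [size_eq b h hg S hS, Set.mem_iUnion]
    constructor
    · intro h1
      refine ⟨leastDepth b h - 1, (leastDepth_and_card_iff hr _).1 ⟨?_, h1⟩⟩
      have := leastDepth_ne_zero hb hg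
      omega
    · rintro ⟨d, hd⟩
      exact ((leastDepth_and_card_iff hr d).2 hd).2
  have hint := integrable_depth_sub_pow b S hS (lg n) k
  have hsum := hasSum_integral_iUnion hmeas
    (fun i j hij => Set.disjoint_left.2 fun h h1 h2 => hij (by
      have a1 := hdepth i h h1
      have a2 := hdepth j h h2
      omega)) hint.integrableOn
  rw [← setIntegral_congr_set hunion] at hsum
  rw [momentD]
  refine hsum.congr_fun ?_
  intro d
  have : ∫ h in s d, ((depth b S h : ℝ) - lg n) ^ k ∂(hashMeasure n) =
      ∫ h in s d, (((d + 1 : ℕ) : ℝ) - lg n) ^ k ∂(hashMeasure n) := by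
    refine setIntegral_congr_ae (hmeas d) ?_
    filter_upwards [depth_ae_eq b S hS] with h hd hh
    rw [hd, hdepth d h hh]
  rw [this, setIntegral_const, (hashMeasure_real_joint hr d).2, smul_eq_mul]

lemma momentW_eq_sum {n : ℕ} (b : ℕ) (hn : 1 ≤ n) (S : List (Fin n)) (hS : ∀ x, x ∈ S) (k : ℕ) :
    momentW b S k = ∑ r ∈ Finset.Icc 1 b,
      ∫ h in {h | size b S h = r}, ((depth b S h : ℝ) - lg n + lg r) ^ k ∂(hashMeasure n) := by
  set s : ℕ → Set (Fin n → ℕ → Bool) := fun r => {h | (zeros h (leastDepth b h)).card = r} with hs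
  have hmeas : ∀ r, MeasurableSet (s r) := fun r => measurableSet_card_leastDepth b fun j => j = r
  have hs_ae : ∀ r, {h | size b S h = r} =ᵐ[hashMeasure n] s r := fun r =>
    size_set_ae_eq b S hS fun j => j = r
  have hunion : {h | 0 < size b S h} =ᵐ[hashMeasure n] ⋃ r ∈ Finset.Icc 1 b, s r := by
    filter_upwards [ae_good n, size_ae_eq b S hS] with h hg hsz
    refine propext ?_
    change 0 < size b S h ↔ h ∈ ⋃ r ∈ Finset.Icc 1 b, s r
    have := hg.card_zeros_le (b := b)
    simp only [hsz, Set.mem_iUnion, Finset.mem_Icc, hs, Set.mem_ofPred_eq, exists_prop]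
    constructor
    · intro h0
      exact ⟨_, ⟨h0, this⟩, rfl⟩
    · rintro ⟨r, hr, rfl⟩
      exact hr.1
  have hint : IntegrableOn (fun h => W b S h ^ k) (⋃ r ∈ Finset.Icc 1 b, s r) (hashMeasure n) :=
    (integrableOn_congr_set_ae hunion).1 (integrableOn_W_pow b hn S hS k)
  rw [momentW, setIntegral_congr_set hunion, integral_biUnion_finset _ (fun r _ => hmeas r)]
  · refine Finset.sum_congr rfl fun r hr => ?_
    rw [setIntegral_congr_set (hs_ae r)]
    refine setIntegral_congr_ae (hmeas r) ?_
    filter_upwards [size_ae_eq b S hS] with h hsz hh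
    have hr0 : size b S h = r := hsz.trans hh
    rw [W_eq hn (by rw [hr0]; exact (Finset.mem_Icc.1 hr).1), hr0]
  · intro i _ j _ hij
    refine Set.disjoint_left.2 fun h h1 h2 => hij ?_
    exact (h1 : _ = i).symm.trans h2
  · intro r hr
    exact hint.mono_set (Set.subset_biUnion_of_mem (u := s) hr)

lemma momentW_one {n : ℕ} (b : ℕ) (hn : 1 ≤ n) (S : List (Fin n)) (hS : ∀ x, x ∈ S) :
    momentW b S 1 = ∑ r ∈ Finset.Icc 1 b, (momentD b S 1 r + probR b S r * lg r) := by
  rw [momentW_eq_sum b hn S hS]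
  refine Finset.sum_congr rfl fun r _ => ?_
  have h1 := (integrable_depth_sub_pow b S hS (lg n) 1).integrableOn (s := {h | size b S h = r})
  simp only [pow_one] at h1
  simp only [pow_one, momentD, probR]
  rw [integral_add h1 (integrable_const _), setIntegral_const, smul_eq_mul]

lemma momentW_two {n : ℕ} (b : ℕ) (hn : 1 ≤ n) (S : List (Fin n)) (hS : ∀ x, x ∈ S) :
    momentW b S 2 = ∑ r ∈ Finset.Icc 1 b,
      (momentD b S 2 r + 2 * (momentD b S 1 r * lg r) + probR b S r * lg r ^ 2) := by
  rw [momentW_eq_sum b hn S hS]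
  refine Finset.sum_congr rfl fun r _ => ?_
  have h1 := (integrable_depth_sub_pow b S hS (lg n) 1).integrableOn (s := {h | size b S h = r})
  have h2 := (integrable_depth_sub_pow b S hS (lg n) 2).integrableOn (s := {h | size b S h = r})
  have h3 : ∀ h, ((depth b S h : ℝ) - lg n + lg r) ^ 2 = ((depth b S h : ℝ) - lg n) ^ 2 +
      (2 * lg r) * ((depth b S h : ℝ) - lg n) ^ 1 + lg r ^ 2 := fun h => by ring
  have h4 : IntegrableOn (fun h => ((depth b S h : ℝ) - lg n) ^ 2 +
      (2 * lg r) * ((depth b S h : ℝ) - lg n) ^ 1) {h | size b S h = r} (hashMeasure n) :=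
    h2.add (h1.const_mul _)
  simp_rw [h3, momentD, probR]
  rw [integral_add h4 (integrable_const _), integral_add h2 (h1.const_mul _),
    integral_const_mul, setIntegral_const, smul_eq_mul]
  ring

open scoped ContDiff SchwartzMap FourierTransform

/-! ### Smooth functions with exponentially decaying derivatives -/

/-- Smooth functions all of whose derivatives are `O(2^{-|η|})`. -/
def ExpDecay (g : ℝ → ℝ) : Prop :=
  ContDiff ℝ ∞ g ∧ ∀ m : ℕ, ∃ C : ℝ, ∀ η, |iteratedDeriv m g η| ≤ C * (2 : ℝ) ^ (-|η|)

lemma ExpDecay.const_mul {g : ℝ → ℝ} (hg : ExpDecay g) (a : ℝ) : ExpDecay fun η => a * g η := by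
  refine ⟨contDiff_const.mul hg.1, fun m => ?_⟩
  obtain ⟨C, hC⟩ := hg.2 m
  refine ⟨|a| * C, fun η => ?_⟩
  rw [iteratedDeriv_const_mul_field, abs_mul, mul_assoc]
  exact mul_le_mul_of_nonneg_left (hC η) (abs_nonneg a)

lemma ExpDecay.add {g₁ g₂ : ℝ → ℝ} (h₁ : ExpDecay g₁) (h₂ : ExpDecay g₂) :
    ExpDecay fun η => g₁ η + g₂ η := by
  refine ⟨h₁.1.add h₂.1, fun m => ?_⟩
  obtain ⟨C₁, hC₁⟩ := h₁.2 m
  obtain ⟨C₂, hC₂⟩ := h₂.2 m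
  refine ⟨C₁ + C₂, fun η => ?_⟩
  rw [iteratedDeriv_fun_add (h₁.1.contDiffAt.of_le (mod_cast le_top))
    (h₂.1.contDiffAt.of_le (mod_cast le_top)), add_mul]
  exact (abs_add_le _ _).trans (add_le_add (hC₁ η) (hC₂ η))

lemma ExpDecay.sub {g₁ g₂ : ℝ → ℝ} (h₁ : ExpDecay g₁) (h₂ : ExpDecay g₂) :
    ExpDecay fun η => g₁ η - g₂ η := by
  have := h₁.add (h₂.const_mul (-1))
  simpa only [neg_mul, one_mul, ← sub_eq_add_neg] using this

lemma expDecay_zero : ExpDecay fun _ => 0 := by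
  refine ⟨contDiff_const, fun m => ⟨0, fun η => ?_⟩⟩
  simp

lemma ExpDecay.sum {ι : Type*} {s : Finset ι} {g : ι → ℝ → ℝ} (h : ∀ i ∈ s, ExpDecay (g i)) :
    ExpDecay fun η => ∑ i ∈ s, g i η := by
  classical
  induction s using Finset.induction_on with
  | empty => simpa using expDecay_zero
  | insert i s hi ih =>
    simp only [Finset.sum_insert hi]
    exact (h i (Finset.mem_insert_self i s)).add
      (ih fun j hj => h j (Finset.mem_insert_of_mem hj))

/-- Meant for `expDiff`: it decays, and its derivative is a combination of decaying kernels,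
although its own two terms do not decay at `+∞`. -/
lemma ExpDecay.of_hasDerivAt {g g' : ℝ → ℝ} (hg : ∀ η, HasDerivAt g (g' η) η)
    (hg' : ExpDecay g') {C : ℝ} (hC : ∀ η, |g η| ≤ C * (2 : ℝ) ^ (-|η|)) : ExpDecay g := by
  have hd : deriv g = g' := funext fun η => (hg η).deriv
  refine ⟨contDiff_infty_iff_deriv.2 ⟨fun η => (hg η).differentiableAt, hd ▸ hg'.1⟩, fun m => ?_⟩
  cases m with
  | zero => exact ⟨C, by simpa using hC⟩
  | succ m =>
    rw [iteratedDeriv_succ', hd]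
    exact hg'.2 m

lemma ExpDecay.bound {g : ℝ → ℝ} (hg : ExpDecay g) :
    ∃ C : ℝ, ∀ η, |g η| ≤ C * (2 : ℝ) ^ (-|η|) := by
  simpa using hg.2 0

lemma pow_mul_two_rpow_neg_le (k : ℕ) : ∃ C : ℝ, ∀ x : ℝ, 0 ≤ x → x ^ k * (2 : ℝ) ^ (-x) ≤ C := by
  refine ⟨k.factorial / Real.log 2 ^ k, fun x hx => ?_⟩
  have hL : 0 < Real.log 2 := Real.log_pos (by norm_num)
  have h := Real.pow_div_factorial_le_exp (Real.log 2 * x) (by positivity) k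
  rw [Real.rpow_def_of_pos (by norm_num), mul_neg, Real.exp_neg, ← div_eq_mul_inv,
    div_le_div_iff₀ (Real.exp_pos _) (by positivity)]
  rw [div_le_iff₀ (by positivity), mul_pow] at h
  linarith

/-- The Schwartz function given by a member of `ExpDecay`. -/
def ExpDecay.toSchwartz {g : ℝ → ℝ} (hg : ExpDecay g) : 𝓢(ℝ, ℂ) where
  toFun η := (g η : ℂ)
  smooth' := Complex.ofRealCLM.contDiff.comp hg.1
  decay' k m := by
    obtain ⟨C, hC⟩ := hg.2 m
    obtain ⟨K, hK⟩ := pow_mul_two_rpow_neg_le k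
    have hC0 : 0 ≤ C := by
      have := (abs_nonneg _).trans (hC 0)
      simpa using this
    refine ⟨C * K, fun η => ?_⟩
    have h1 : ‖iteratedFDeriv ℝ m (fun η => (g η : ℂ)) η‖ = |iteratedDeriv m g η| := by
      have := Complex.ofRealLI.norm_iteratedFDeriv_comp_left (f := g) (x := η) (i := m) (n := ∞)
        hg.1.contDiffAt (mod_cast le_top)
      rw [← Real.norm_eq_abs, ← norm_iteratedFDeriv_eq_norm_iteratedDeriv, ← this]
      rfl
    rw [h1, Real.norm_eq_abs]
    calc |η| ^ k * |iteratedDeriv m g η| ≤ |η| ^ k * (C * (2 : ℝ) ^ (-|η|)) := by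
          gcongr; exact hC η
      _ = C * (|η| ^ k * (2 : ℝ) ^ (-|η|)) := by ring
      _ ≤ C * K := by gcongr; exact hK _ (abs_nonneg η)

/-- The Schwartz function `η ^ k * g η`. -/
def ExpDecay.momentSchwartz {g : ℝ → ℝ} (hg : ExpDecay g) (k : ℕ) : 𝓢(ℝ, ℂ) :=
  SchwartzMap.smulLeftCLM ℂ (fun η : ℝ => (η : ℂ) ^ k) hg.toSchwartz

lemma ExpDecay.momentSchwartz_apply {g : ℝ → ℝ} (hg : ExpDecay g) (k : ℕ) (η : ℝ) :
    hg.momentSchwartz k η = (η : ℂ) ^ k * (g η : ℂ) := by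
  have h1 : Function.HasTemperateGrowth (fun η : ℝ => (η : ℂ)) :=
    Complex.ofRealCLM.hasTemperateGrowth
  have : Function.HasTemperateGrowth (fun η : ℝ => (η : ℂ) ^ k) := by fun_prop
  rw [momentSchwartz, SchwartzMap.smulLeftCLM_apply_apply this, smul_eq_mul]
  rfl

lemma ExpDecay.fourier_momentSchwartz {g : ℝ → ℝ} (hg : ExpDecay g) (k : ℕ) (l : ℝ) :
    𝓕 (hg.momentSchwartz k) l =
      ∫ η : ℝ, (η : ℂ) ^ k * (Complex.exp (-(2 * l * Real.pi * Complex.I) * η) * (g η : ℂ)) := by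
  rw [SchwartzMap.fourier_coe, Real.fourier_eq']
  refine integral_congr_ae (ae_of_all _ fun η => ?_)
  simp only [hg.momentSchwartz_apply, smul_eq_mul, RCLike.inner_apply, conj_trivial]
  rw [← mul_assoc, mul_comm (Complex.exp _), mul_assoc]
  congr 3
  push_cast
  ring

/-- The Fourier transform of a Schwartz function is Schwartz, hence `O(|l|^{-2})` on the integers.
-/
lemma ExpDecay.summable_fourier {g : ℝ → ℝ} (hg : ExpDecay g) (k : ℕ) :
    Summable fun l : ℤ => ‖𝓕 (hg.momentSchwartz k) (l : ℝ)‖ := by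
  refine summable_of_isBigO (Real.summable_abs_int_rpow one_lt_two) ?_
  exact (((𝓕 (hg.momentSchwartz k)).isBigO_cocompact_rpow (-2)).norm_left).comp_tendsto
    Int.tendsto_coe_cofinite

lemma ExpDecay.poisson {g : ℝ → ℝ} (hg : ExpDecay g) (k : ℕ) (x : ℝ) :
    ∑' m : ℤ, ((((m : ℝ) - x) ^ k * g (m - x) : ℝ) : ℂ) =
      ∑' l : ℤ, 𝓕 (hg.momentSchwartz k) (l : ℝ) *
        Complex.exp (-(2 * l * Real.pi * Complex.I * x)) := by
  have h := SchwartzMap.tsum_eq_tsum_fourier (hg.momentSchwartz k) (-x)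
  have e1 : ∀ m : ℤ, hg.momentSchwartz k (-x + m) = ((((m : ℝ) - x) ^ k * g (m - x) : ℝ) : ℂ) := by
    intro m
    rw [hg.momentSchwartz_apply, show -x + (m : ℝ) = m - x by ring]
    push_cast
    rfl
  simp_rw [e1] at h
  rw [h]
  refine tsum_congr fun l => ?_
  rw [fourier_coe_apply]
  congr 2
  push_cast
  ring

/-! ### The limiting kernel -/

/-- The function `u ^ j * exp (-(c * u))` of `u = 2 ^ (-η)`. -/
def kernel (j : ℕ) (c η : ℝ) : ℝ := ((2 : ℝ) ^ (-η)) ^ j * Real.exp (-(c * (2 : ℝ) ^ (-η)))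

lemma hasDerivAt_two_rpow_neg (η : ℝ) :
    HasDerivAt (fun η : ℝ => (2 : ℝ) ^ (-η)) (-(Real.log 2 * (2 : ℝ) ^ (-η))) η := by
  have := (hasDerivAt_neg η).const_rpow (a := 2) (by norm_num)
  convert this using 1
  ring

/-- From `du/dη = -(log 2) u`. Kernels with fixed `c` thus span a space stable under
differentiation, and the exponent `j` never drops; this drives the induction in `expDecay_kernel`.
-/
lemma hasDerivAt_kernel (j : ℕ) (c η : ℝ) :
    HasDerivAt (kernel j c)
      (c * Real.log 2 * kernel (j + 1) c η - j * Real.log 2 * kernel j c η) η := by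
  have h1 := hasDerivAt_two_rpow_neg η
  have h2 := (h1.pow j).mul (h1.const_mul c).neg.exp
  refine (h2.congr_deriv ?_).congr_of_eventuallyEq (Eventually.of_forall fun _ => rfl)
  cases j with
  | zero => simp [kernel]; ring
  | succ j => simp only [kernel, Pi.neg_apply, Nat.add_sub_cancel, Pi.pow_apply]; push_cast; ring

lemma contDiff_kernel (j : ℕ) (c : ℝ) : ContDiff ℝ ∞ (kernel j c) := by
  have h1 : ContDiff ℝ ∞ fun η : ℝ => (2 : ℝ) ^ (-η) :=
    contDiff_const.rpow contDiff_neg (fun _ => by norm_num)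
  exact (h1.pow j).mul (contDiff_const.mul h1).neg.exp

lemma kernel_nonneg (j : ℕ) (c η : ℝ) : 0 ≤ kernel j c η := by unfold kernel; positivity

lemma pow_mul_exp_neg_le (i : ℕ) {u : ℝ} (hu : 0 ≤ u) : u ^ i * Real.exp (-u) ≤ i.factorial := by
  have h := Real.pow_div_factorial_le_exp u hu i
  rw [div_le_iff₀ (by positivity)] at h
  rw [Real.exp_neg, ← div_eq_mul_inv, div_le_iff₀ (Real.exp_pos _)]
  linarith

/-- For `η ≥ 0` one factor `u = 2^{-|η|}` is split off, which needs `i ≥ 1`. For `η ≤ 0`, `1/u =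
2^{-|η|}`, and one more power of `u` is absorbed by `e^{-u}`. -/
lemma pow_mul_exp_neg_le_two_rpow {i : ℕ} (hi : 1 ≤ i) (η : ℝ) :
    ((2 : ℝ) ^ (-η)) ^ i * Real.exp (-(2 : ℝ) ^ (-η)) ≤ (i + 1).factorial * (2 : ℝ) ^ (-|η|) := by
  have hu : 0 < (2 : ℝ) ^ (-η) := by positivity
  rcases le_total 0 η with h | h
  · rw [abs_of_nonneg h]
    obtain ⟨i, rfl⟩ := Nat.exists_eq_add_of_le' hi
    have h1 := pow_mul_exp_neg_le i hu.le
    have h2 : (i.factorial : ℝ) ≤ ((i + 1 + 1).factorial : ℝ) := by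
      exact_mod_cast Nat.factorial_le (by omega)
    calc ((2 : ℝ) ^ (-η)) ^ (i + 1) * Real.exp (-(2 : ℝ) ^ (-η))
        = (((2 : ℝ) ^ (-η)) ^ i * Real.exp (-(2 : ℝ) ^ (-η))) * (2 : ℝ) ^ (-η) := by ring
      _ ≤ ((i + 1 + 1).factorial : ℝ) * (2 : ℝ) ^ (-η) := by gcongr; linarith
  · rw [abs_of_nonpos h, neg_neg]
    have h1 := pow_mul_exp_neg_le (i + 1) hu.le
    have h3 : (2 : ℝ) ^ η * (2 : ℝ) ^ (-η) = 1 := by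
      rw [← Real.rpow_add (by norm_num)]; simp
    calc ((2 : ℝ) ^ (-η)) ^ i * Real.exp (-(2 : ℝ) ^ (-η))
        = (((2 : ℝ) ^ (-η)) ^ i * Real.exp (-(2 : ℝ) ^ (-η))) * ((2 : ℝ) ^ η * (2 : ℝ) ^ (-η)) := by
          rw [h3, mul_one]
      _ = (((2 : ℝ) ^ (-η)) ^ (i + 1) * Real.exp (-(2 : ℝ) ^ (-η))) * (2 : ℝ) ^ η := by ring
      _ ≤ ((i + 1).factorial : ℝ) * (2 : ℝ) ^ η := by gcongr

lemma kernel_le {j : ℕ} (hj : 1 ≤ j) {c : ℝ} (hc : 1 ≤ c) (η : ℝ) :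
    kernel j c η ≤ (j + 1).factorial * (2 : ℝ) ^ (-|η|) := by
  refine le_trans ?_ (pow_mul_exp_neg_le_two_rpow hj η)
  have hu : 0 < (2 : ℝ) ^ (-η) := by positivity
  unfold kernel
  gcongr
  nlinarith

lemma expDecay_kernel {j : ℕ} (hj : 1 ≤ j) {c : ℝ} (hc : 1 ≤ c) : ExpDecay (kernel j c) := by
  refine ⟨contDiff_kernel j c, fun m => ?_⟩
  induction m generalizing j with
  | zero =>
    refine ⟨(j + 1).factorial, fun η => ?_⟩
    rw [iteratedDeriv_zero, abs_of_nonneg (kernel_nonneg j c η)]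
    exact kernel_le hj hc η
  | succ m ih =>
    obtain ⟨C₁, hC₁⟩ := ih hj
    obtain ⟨C₂, hC₂⟩ := ih (j := j + 1) (by omega)
    have hd : deriv (kernel j c) =
        fun η => c * Real.log 2 * kernel (j + 1) c η - j * Real.log 2 * kernel j c η :=
      funext fun η => (hasDerivAt_kernel j c η).deriv
    refine ⟨|c * Real.log 2| * C₂ + |j * Real.log 2| * C₁, fun η => ?_⟩
    have c1 : ∀ i, ContDiffAt ℝ m (kernel i c) η := fun i =>
      (contDiff_kernel i c).contDiffAt.of_le (mod_cast le_top)
    rw [iteratedDeriv_succ', hd, iteratedDeriv_fun_sub (contDiffAt_const.mul (c1 (j + 1)))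
      (contDiffAt_const.mul (c1 j)), iteratedDeriv_const_mul_field, iteratedDeriv_const_mul_field]
    refine (abs_sub _ _).trans ?_
    rw [add_mul]
    refine add_le_add ?_ ?_
    · exact (abs_mul _ _).trans_le ((mul_le_mul_of_nonneg_left (hC₂ η) (abs_nonneg _)).trans_eq
        (mul_assoc _ _ _).symm)
    · exact (abs_mul _ _).trans_le ((mul_le_mul_of_nonneg_left (hC₁ η) (abs_nonneg _)).trans_eq
        (mul_assoc _ _ _).symm)

/-- The difference `exp (-u) - exp (-2u)` of `u = 2 ^ (-η)`. -/
def expDiff (η : ℝ) : ℝ := kernel 0 1 η - kernel 0 2 η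

lemma hasDerivAt_expDiff (η : ℝ) :
    HasDerivAt expDiff (Real.log 2 * kernel 1 1 η - 2 * Real.log 2 * kernel 1 2 η) η := by
  have := (hasDerivAt_kernel 0 1 η).sub (hasDerivAt_kernel 0 2 η)
  refine (this.congr_deriv ?_).congr_of_eventuallyEq (Eventually.of_forall fun _ => rfl)
  simp

/-- The size bound comes from `0 ≤ e^{-u} (1 - e^{-u}) ≤ u e^{-u}`. -/
lemma expDecay_expDiff : ExpDecay expDiff := by
  refine ExpDecay.of_hasDerivAt (C := 2) hasDerivAt_expDiff
    (((expDecay_kernel le_rfl le_rfl).const_mul _).sub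
      ((expDecay_kernel le_rfl one_le_two).const_mul _)) fun η => ?_
  have h1 := pow_mul_exp_neg_le_two_rpow (le_refl 1) η
  set u := (2 : ℝ) ^ (-η) with hu
  have hu0 : 0 < u := by positivity
  have e1 : expDiff η = Real.exp (-u) * (1 - Real.exp (-u)) := by
    simp only [expDiff, kernel, pow_zero, one_mul, ← hu]
    rw [mul_sub, ← Real.exp_add]
    ring_nf
  have h2 : 1 - Real.exp (-u) ≤ u := by have := Real.add_one_le_exp (-u); linarith
  have h3 : 0 ≤ 1 - Real.exp (-u) := by
    have : Real.exp (-u) ≤ 1 := Real.exp_le_one_iff.2 (by linarith)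
    linarith
  rw [e1, abs_of_nonneg (by positivity)]
  refine le_trans ?_ (h1.trans (by simp [Nat.factorial]))
  rw [pow_one, mul_comm]
  gcongr

lemma two_rpow_neg_natCast_mul (m : ℕ) (η : ℝ) :
    (2 : ℝ) ^ (-((m : ℝ) * η)) = ((2 : ℝ) ^ (-η)) ^ m := by
  rw [← Real.rpow_mul_natCast (by norm_num)]
  congr 1
  ring

lemma f_eq_kernel (b r : ℕ) (η : ℝ) :
    f b r η = (kernel r 1 η - ∑ k ∈ Finset.range (b - r + 1), kernel (r + k) 2 η / k.factorial) /
      r.factorial := by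
  simp only [f, kernel, two_rpow_neg_natCast_mul]
  rw [sub_div, mul_sub, Finset.mul_sum, Finset.mul_sum, Finset.sum_div]
  congr 1
  · ring_nf
  · refine Finset.sum_congr rfl fun k _ => ?_
    rw [show Real.exp (-(2 * (2 : ℝ) ^ (-η))) =
      Real.exp (-(2 : ℝ) ^ (-η)) * Real.exp (-(2 : ℝ) ^ (-η)) by rw [← Real.exp_add]; ring_nf]
    ring

/-- The `k = 0` term `e^{-2u}` tends to `1` as `η → ∞`; it has to be paired with `e^{-u}` before any
decay is visible. -/
lemma f_zero_eq (b : ℕ) (η : ℝ) :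
    f b 0 η = expDiff η -
      ∑ k ∈ Finset.range b, (((k + 1).factorial : ℝ))⁻¹ * kernel (k + 1) 2 η := by
  rw [f_eq_kernel, Nat.sub_zero, Finset.sum_range_succ']
  simp only [expDiff, zero_add, Nat.factorial_zero, Nat.cast_one, div_one]
  rw [add_comm, ← sub_sub]
  congr 1
  exact Finset.sum_congr rfl fun k _ => by rw [div_eq_inv_mul]

lemma expDecay_f (b r : ℕ) : ExpDecay (f b r) := by
  cases r with
  | zero =>
    rw [show f b 0 = _ from funext (f_zero_eq b)]
    exact expDecay_expDiff.sub (ExpDecay.sum fun k _ =>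
      (expDecay_kernel (by omega) one_le_two).const_mul _)
  | succ r =>
    have : f b (r + 1) = fun η => ((r + 1).factorial : ℝ)⁻¹ * (kernel (r + 1) 1 η -
        ∑ k ∈ Finset.range (b - (r + 1) + 1), (k.factorial : ℝ)⁻¹ * kernel (r + 1 + k) 2 η) := by
      funext η
      rw [f_eq_kernel, div_eq_inv_mul]
      congr 2
      exact Finset.sum_congr rfl fun k _ => by rw [div_eq_inv_mul]
    rw [this]
    exact ((expDecay_kernel (by omega) le_rfl).sub (ExpDecay.sum fun k _ =>
      (expDecay_kernel (by omega) one_le_two).const_mul _)).const_mul _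

/-- A partial sum of the exponential series at `u` is at most `e^u`. Nonnegativity lets `f` serve as
a density in `ExpDecay.laplace_eq_complexMGF`. -/
lemma f_nonneg (b r : ℕ) (η : ℝ) : 0 ≤ f b r η := by
  have hu : 0 < (2 : ℝ) ^ (-η) := by positivity
  have h1 := Real.sum_le_exp_of_nonneg hu.le (b - r + 1)
  unfold f
  refine mul_nonneg (by positivity) (sub_nonneg.2 ?_)
  simp only [two_rpow_neg_natCast_mul]
  calc _ ≤ Real.exp (-(2 : ℝ) ^ (-η)) * Real.exp ((2 : ℝ) ^ (-η)) := by gcongr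
    _ = 1 := by rw [← Real.exp_add]; simp

/-! ### Two-sided Laplace transforms -/

/-- The two-sided Laplace transform `∫ exp (α η) g η dη`. -/
def laplace (g : ℝ → ℝ) (α : ℂ) : ℂ := ∫ η : ℝ, Complex.exp (α * η) * (g η : ℂ)

lemma phi_eq_laplace (b r : ℕ) : phi b r = laplace (f b r) := rfl

lemma log_two_pos : 0 < Real.log 2 := Real.log_pos (by norm_num)

lemma L_ne_zero : L ≠ 0 := Complex.ofReal_ne_zero.2 log_two_pos.ne'

lemma integrable_exp_mul_two_rpow {t : ℝ} (ht : |t| < Real.log 2) :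
    Integrable fun η : ℝ => Real.exp (t * η) * (2 : ℝ) ^ (-|η|) := by
  rw [abs_lt] at ht
  rw [← integrableOn_univ, ← Set.Iic_union_Ioi (a := (0 : ℝ))]
  refine IntegrableOn.union ?_ ?_
  · refine (integrableOn_exp_mul_Iic (a := t + Real.log 2) (by linarith) 0).congr_fun
      (fun η hη => ?_) measurableSet_Iic
    simp only
    rw [abs_of_nonpos hη, Real.rpow_def_of_pos (by norm_num), ← Real.exp_add]
    ring_nf
  · refine (integrableOn_exp_mul_Ioi (a := t - Real.log 2) (by linarith) 0).congr_fun
      (fun η hη => ?_) measurableSet_Ioi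
    simp only
    rw [abs_of_pos hη, Real.rpow_def_of_pos (by norm_num), ← Real.exp_add]
    ring_nf

lemma ExpDecay.continuous {g : ℝ → ℝ} (hg : ExpDecay g) : Continuous g := hg.1.continuous

lemma ExpDecay.integrable_exp_mul {g : ℝ → ℝ} (hg : ExpDecay g) {t : ℝ}
    (ht : |t| < Real.log 2) : Integrable fun η : ℝ => Real.exp (t * η) * g η := by
  obtain ⟨C, hC⟩ := hg.bound
  refine ((integrable_exp_mul_two_rpow ht).const_mul C).mono' ?_ (ae_of_all _ fun η => ?_)
  · exact (Continuous.mul (by fun_prop) hg.continuous).aestronglyMeasurable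
  · rw [norm_mul, Real.norm_of_nonneg (Real.exp_nonneg _), Real.norm_eq_abs]
    calc Real.exp (t * η) * |g η| ≤ Real.exp (t * η) * (C * (2 : ℝ) ^ (-|η|)) := by
          gcongr; exact hC η
      _ = _ := by ring

lemma ExpDecay.integrable_laplace {g : ℝ → ℝ} (hg : ExpDecay g) {α : ℂ}
    (hα : |α.re| < Real.log 2) :
    Integrable fun η : ℝ => Complex.exp (α * η) * (g η : ℂ) := by
  refine (hg.integrable_exp_mul hα).mono ?_ (ae_of_all _ fun η => ?_)
  · have := hg.continuous
    exact Continuous.aestronglyMeasurable (by fun_prop)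
  · simp [Complex.norm_exp]

lemma laplace_sub {g₁ g₂ : ℝ → ℝ} (h₁ : ExpDecay g₁) (h₂ : ExpDecay g₂) {α : ℂ}
    (hα : |α.re| < Real.log 2) :
    laplace (fun η => g₁ η - g₂ η) α = laplace g₁ α - laplace g₂ α := by
  rw [laplace, laplace, laplace,
    ← integral_sub (h₁.integrable_laplace hα) (h₂.integrable_laplace hα)]
  congr 1
  funext η
  push_cast
  ring

lemma laplace_const_mul (g : ℝ → ℝ) (a : ℝ) (α : ℂ) :
    laplace (fun η => a * g η) α = a * laplace g α := by
  rw [laplace, laplace, ← integral_const_mul]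
  congr 1
  funext η
  push_cast
  ring

lemma laplace_sum {ι : Type*} {s : Finset ι} {g : ι → ℝ → ℝ} (h : ∀ i ∈ s, ExpDecay (g i)) {α : ℂ}
    (hα : |α.re| < Real.log 2) :
    laplace (fun η => ∑ i ∈ s, g i η) α = ∑ i ∈ s, laplace (g i) α := by
  simp only [laplace]
  rw [← integral_finsetSum _ fun i hi => (h i hi).integrable_laplace hα]
  congr 1
  funext η
  push_cast
  rw [Finset.mul_sum]

/-- Seen as the moment generating function of the measure with density `g`, the transform is
analytic in the strip `|Re α| < log 2` and can be differentiated under the integral sign. -/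
lemma ExpDecay.laplace_eq_complexMGF {g : ℝ → ℝ} (hg : ExpDecay g) (h0 : ∀ η, 0 ≤ g η) :
    laplace g = ProbabilityTheory.complexMGF id
      (volume.withDensity fun η => ENNReal.ofReal (g η)) := by
  funext α
  rw [ProbabilityTheory.complexMGF, integral_withDensity_eq_integral_toReal_smul
    hg.continuous.measurable.ennreal_ofReal (ae_of_all _ fun _ => ENNReal.ofReal_lt_top), laplace]
  congr 1
  funext η
  rw [ENNReal.toReal_ofReal (h0 η), Complex.real_smul, mul_comm]
  rfl

lemma ExpDecay.mem_interior_integrableExpSet {g : ℝ → ℝ} (hg : ExpDecay g) (h0 : ∀ η, 0 ≤ g η)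
    {t : ℝ} (ht : |t| < Real.log 2) :
    t ∈ interior (ProbabilityTheory.integrableExpSet id
      (volume.withDensity fun η => ENNReal.ofReal (g η))) := by
  rw [mem_interior]
  refine ⟨Set.Ioo (-Real.log 2) (Real.log 2), fun s hs => ?_, isOpen_Ioo, abs_lt.1 ht⟩
  change Integrable _ _
  rw [integrable_withDensity_iff hg.continuous.measurable.ennreal_ofReal
    (ae_of_all _ fun _ => ENNReal.ofReal_lt_top)]
  refine (hg.integrable_exp_mul (abs_lt.2 hs)).congr (ae_of_all _ fun η => ?_)
  simp only [id, ENNReal.toReal_ofReal (h0 η)]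

lemma ExpDecay.iteratedDeriv_laplace {g : ℝ → ℝ} (hg : ExpDecay g) (h0 : ∀ η, 0 ≤ g η) (k : ℕ)
    {α : ℂ} (hα : |α.re| < Real.log 2) :
    iteratedDeriv k (laplace g) α =
      ∫ η : ℝ, (η : ℂ) ^ k * (Complex.exp (α * η) * (g η : ℂ)) := by
  rw [hg.laplace_eq_complexMGF h0,
    ProbabilityTheory.iteratedDeriv_complexMGF (hg.mem_interior_integrableExpSet h0 hα),
    integral_withDensity_eq_integral_toReal_smul
    hg.continuous.measurable.ennreal_ofReal (ae_of_all _ fun _ => ENNReal.ofReal_lt_top)]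
  congr 1
  funext η
  rw [ENNReal.toReal_ofReal (h0 η), Complex.real_smul]
  simp only [id]
  ring

lemma ExpDecay.analyticAt_laplace {g : ℝ → ℝ} (hg : ExpDecay g) (h0 : ∀ η, 0 ≤ g η)
    {α : ℂ} (hα : |α.re| < Real.log 2) : AnalyticAt ℂ (laplace g) α := by
  rw [hg.laplace_eq_complexMGF h0]
  exact ProbabilityTheory.analyticAt_complexMGF (hg.mem_interior_integrableExpSet h0 hα)

/-- The substitution `t = 2^{-η}` gives the Gamma integral of `t^{a-1} e^{-ct}` with `a = j - α/L`;
in the strip, `j ≥ 1` ensures `Re a > 0`. -/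
lemma laplace_kernel {j : ℕ} (hj : 1 ≤ j) {c : ℝ} (hc : 0 < c) {α : ℂ}
    (hα : |α.re| < Real.log 2) :
    laplace (kernel j c) α = (1 / (c : ℂ)) ^ (j - α / L) * Complex.Gamma (j - α / L) / L := by
  set a : ℂ := j - α / L with ha
  have hL := log_two_pos
  have hare : 0 < a.re := by
    have h1 : α.re / Real.log 2 < 1 := by
      rw [div_lt_one hL]; exact (le_abs_self _).trans_lt hα
    have h2 : (1 : ℝ) ≤ j := by exact_mod_cast hj
    have h3 : (α / L).re = α.re / Real.log 2 := by rw [L, Complex.div_ofReal_re]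
    rw [ha, Complex.sub_re, h3, Complex.natCast_re]
    linarith
  have himg : (fun η : ℝ => (2 : ℝ) ^ (-η)) '' Set.univ = Set.Ioi 0 := by
    ext u
    simp only [Set.image_univ, Set.mem_range, Set.mem_Ioi]
    constructor
    · rintro ⟨η, rfl⟩; positivity
    · intro hu
      refine ⟨-Real.logb 2 u, ?_⟩
      rw [neg_neg, Real.rpow_logb (by norm_num) (by norm_num) hu]
  have hinj : Set.InjOn (fun η : ℝ => (2 : ℝ) ^ (-η)) Set.univ := by
    intro x _ y _ hxy
    have := (Real.rpow_right_inj (by norm_num : (0 : ℝ) < 2) (by norm_num)).1 hxy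
    linarith
  have hcv := integral_image_eq_integral_abs_deriv_smul MeasurableSet.univ
    (fun η _ => (hasDerivAt_two_rpow_neg η).hasDerivWithinAt) hinj
    (fun t : ℝ => (t : ℂ) ^ (a - 1) * Complex.exp (-(c * t)))
  rw [himg, Complex.integral_cpow_mul_exp_neg_mul_Ioi hare hc, setIntegral_univ] at hcv
  rw [hcv, eq_div_iff L_ne_zero, laplace, ← integral_mul_const]
  congr 1
  funext η
  have hu : (0 : ℝ) < (2 : ℝ) ^ (-η) := by positivity
  have hu' : (((2 : ℝ) ^ (-η) : ℝ) : ℂ) ≠ 0 := Complex.ofReal_ne_zero.2 hu.ne'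
  have hlog : Complex.log (((2 : ℝ) ^ (-η) : ℝ) : ℂ) = -(η * L) := by
    rw [← Complex.ofReal_log hu.le, Real.log_rpow (by norm_num), L]
    push_cast; ring
  have hpow : (((2 : ℝ) ^ (-η) : ℝ) : ℂ) ^ a =
      Complex.exp (α * η) * (((2 : ℝ) ^ (-η) : ℝ) : ℂ) ^ j := by
    rw [ha, Complex.cpow_sub _ _ hu', Complex.cpow_natCast, Complex.cpow_def_of_ne_zero hu', hlog,
      div_eq_mul_inv, ← Complex.exp_neg, mul_comm]
    congr 2
    field_simp [L_ne_zero]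
  have habs : |-(Real.log 2 * (2 : ℝ) ^ (-η))| = Real.log 2 * (2 : ℝ) ^ (-η) := by
    rw [abs_neg, abs_of_pos (by positivity)]
  rw [habs, Complex.cpow_sub _ _ hu', Complex.cpow_one, hpow, Complex.real_smul, kernel, L]
  push_cast
  field_simp

/-- Integration by parts: the derivative of `expDiff` involves only kernels with `j = 1`. The factor
`α` stays on the left so that `α = 0` is included. -/
lemma laplace_expDiff_mul {α : ℂ} (hα : |α.re| < Real.log 2) :
    α * laplace expDiff α = (Complex.exp α - 1) * Complex.Gamma (1 - α / L) := by
  have d1 := expDecay_kernel le_rfl (le_refl (1 : ℝ))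
  have d2 := expDecay_kernel le_rfl one_le_two
  have hd : ExpDecay fun η => Real.log 2 * kernel 1 1 η - 2 * Real.log 2 * kernel 1 2 η :=
    (d1.const_mul _).sub (d2.const_mul _)
  have hparts := integral_mul_deriv_eq_deriv_mul_of_integrable
    (u := fun η : ℝ => Complex.exp (α * η)) (v := fun η => (expDiff η : ℂ))
    (u' := fun η : ℝ => α * Complex.exp (α * η))
    (v' := fun η => ((Real.log 2 * kernel 1 1 η - 2 * Real.log 2 * kernel 1 2 η : ℝ) : ℂ))
    (fun η _ => by
      have h1 : HasDerivAt (fun x : ℝ => α * (x : ℂ)) (α * 1) η :=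
        (Complex.ofRealCLM.hasDerivAt).const_mul α
      simpa [mul_comm] using h1.cexp)
    (fun η _ => (hasDerivAt_expDiff η).ofReal_comp)
    (hd.integrable_laplace hα)
    (by
      refine ((expDecay_expDiff.integrable_laplace hα).const_mul α).congr (ae_of_all _ fun η => ?_)
      simp only [Pi.mul_apply]; ring)
    (expDecay_expDiff.integrable_laplace hα)
  have e1 : ∫ η : ℝ, α * Complex.exp (α * η) * (expDiff η : ℂ) = α * laplace expDiff α := by
    rw [laplace, ← integral_const_mul]
    congr 1
    funext η
    ring
  have e2 := laplace_sub (d1.const_mul (Real.log 2)) (d2.const_mul (2 * Real.log 2)) hα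
  rw [laplace_const_mul, laplace_const_mul, laplace_kernel le_rfl one_pos hα,
    laplace_kernel le_rfl two_pos hα, laplace] at e2
  rw [e1, e2] at hparts
  have hpow : (1 / (2 : ℂ)) ^ (1 - α / L) = Complex.exp α / 2 := by
    have h2 : (1 / 2 : ℂ) ≠ 0 := by norm_num
    have hlog : Complex.log (1 / 2) = -L := by
      rw [show (1 / 2 : ℂ) = ((1 / 2 : ℝ) : ℂ) by push_cast; rfl, ← Complex.ofReal_log (by norm_num),
        L, one_div, Real.log_inv]
      push_cast; rfl
    rw [Complex.cpow_sub _ _ h2, Complex.cpow_one, Complex.cpow_def_of_ne_zero h2, hlog,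
      div_eq_mul_inv, ← Complex.exp_neg]
    rw [show -(-L * (α / L)) = α by field_simp [L_ne_zero]]
    ring
  push_cast at hparts
  rw [hpow] at hparts
  rw [← neg_inj, ← hparts]
  have : ((Real.log 2 : ℝ) : ℂ) ≠ 0 := L_ne_zero
  simp only [L, Complex.one_cpow, div_one]
  field_simp
  ring

/-! ### The first derivative of the Laplace transform of the limiting kernel -/

lemma L_mul_chi (l : ℤ) : L * chi l = 2 * l * Real.pi * Complex.I := by
  rw [chi, mul_div_cancel₀ _ L_ne_zero]

lemma neg_L_mul_chi_re (l : ℤ) : (-(L * chi l)).re = 0 := by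
  rw [L_mul_chi]; simp

lemma abs_neg_L_mul_chi_re_lt (l : ℤ) : |(-(L * chi l)).re| < Real.log 2 := by
  rw [neg_L_mul_chi_re, abs_zero]; exact log_two_pos

lemma chi_re (l : ℤ) : (chi l).re = 0 := by
  rw [chi, L, Complex.div_ofReal_re]; simp

lemma chi_ne_zero {l : ℤ} (hl : l ≠ 0) : chi l ≠ 0 := by
  have h2 : (2 * (l : ℂ) * Real.pi * Complex.I) ≠ 0 := by
    have : (Real.pi : ℂ) ≠ 0 := Complex.ofReal_ne_zero.2 Real.pi_ne_zero
    have : (l : ℂ) ≠ 0 := Int.cast_ne_zero.2 hl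
    simp [*]
  exact div_ne_zero h2 L_ne_zero

lemma exp_neg_L_mul_chi (l : ℤ) : Complex.exp (-(L * chi l)) = 1 := by
  rw [L_mul_chi, Complex.exp_neg, inv_eq_one]
  rw [show 2 * (l : ℂ) * Real.pi * Complex.I = l * (2 * Real.pi * Complex.I) by ring]
  exact Complex.exp_int_mul_two_pi_mul_I l

lemma eventually_abs_re_lt {α₀ : ℂ} (h : |α₀.re| < Real.log 2) :
    ∀ᶠ α in nhds α₀, |α.re| < Real.log 2 :=
  (isOpen_lt (by fun_prop) continuous_const).mem_nhds h

lemma add_chi_ne_neg_natCast {j : ℕ} (hj : 1 ≤ j) (l : ℤ) (m : ℕ) : (j : ℂ) + chi l ≠ -m := by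
  intro h
  have h1 := congrArg Complex.re h
  simp only [Complex.add_re, Complex.natCast_re, chi_re, Complex.neg_re, add_zero] at h1
  have h2 : (1 : ℝ) ≤ j := by exact_mod_cast hj
  have h3 : (0 : ℝ) ≤ m := by positivity
  linarith

lemma hasDerivAt_Gamma_digamma {z : ℂ} (hz : ∀ m : ℕ, z ≠ -m) :
    HasDerivAt Complex.Gamma (Complex.digamma z * Complex.Gamma z) z := by
  have h := (Complex.differentiableAt_Gamma z hz).hasDerivAt
  rwa [Complex.digamma_def, logDeriv_apply, div_mul_cancel₀ _ (Complex.Gamma_ne_zero hz)]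

lemma sub_div_L_at (j : ℕ) (l : ℤ) : (j : ℂ) - -(L * chi l) / L = j + chi l := by
  have := L_ne_zero
  field_simp
  ring

lemma hasDerivAt_sub_div_L (j α₀ : ℂ) : HasDerivAt (fun α : ℂ => j - α / L) (-(1 / L)) α₀ := by
  simpa using ((hasDerivAt_id α₀).div_const L).const_sub j

lemma hasDerivAt_laplace_kernel {j : ℕ} (hj : 1 ≤ j) {c : ℝ} (hc : 0 < c) (l : ℤ) :
    HasDerivAt (laplace (kernel j c))
      (-((1 / (c : ℂ)) ^ (j + chi l) * (Complex.digamma (j + chi l) + Complex.log (1 / c)) *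
        Complex.Gamma (j + chi l)) / L ^ 2) (-(L * chi l)) := by
  have hc0 : (1 / (c : ℂ)) ≠ 0 := one_div_ne_zero (Complex.ofReal_ne_zero.2 hc.ne')
  have h1 := hasDerivAt_sub_div_L j (-(L * chi l))
  have h2 := h1.const_cpow (c := 1 / (c : ℂ)) (Or.inl hc0)
  have hz := sub_div_L_at j l
  have h3 : HasDerivAt Complex.Gamma _ ((j : ℂ) - -(L * chi l) / L) :=
    hasDerivAt_Gamma_digamma (by rw [hz]; exact add_chi_ne_neg_natCast hj l)
  have h4 := ((h2.mul (HasDerivAt.comp (h := fun α : ℂ => (j : ℂ) - α / L) (-(L * chi l)) h3 h1)).div_const L).congr_of_eventuallyEq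
    ((eventually_abs_re_lt (abs_neg_L_mul_chi_re_lt l)).mono fun α hα => by
      exact laplace_kernel hj hc hα)
  refine h4.congr_deriv ?_
  simp only [Function.comp_apply, hz]
  have := L_ne_zero
  field_simp
  ring

lemma hasDerivAt_laplace_kernel_one {j : ℕ} (hj : 1 ≤ j) (l : ℤ) :
    HasDerivAt (laplace (kernel j 1))
      (-(Complex.digamma (j + chi l) * Complex.Gamma (j + chi l)) / L ^ 2) (-(L * chi l)) := by
  simpa using hasDerivAt_laplace_kernel hj one_pos l

/-- Since `2^{χ_l} = 1`, the factor `(1/2)^{j + χ_l}` loses its dependence on `l`; the `-L` is `log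
(1/2)`. -/
lemma hasDerivAt_laplace_kernel_two {j : ℕ} (hj : 1 ≤ j) (l : ℤ) :
    HasDerivAt (laplace (kernel j 2))
      (-((2 : ℂ)⁻¹ ^ j * (Complex.digamma (j + chi l) - L) * Complex.Gamma (j + chi l)) / L ^ 2)
      (-(L * chi l)) := by
  have h2 : (1 / ((2 : ℝ) : ℂ)) ≠ 0 := by norm_num
  have hlog : Complex.log (1 / ((2 : ℝ) : ℂ)) = -L := by
    rw [show (1 / ((2 : ℝ) : ℂ)) = ((1 / 2 : ℝ) : ℂ) by push_cast; rfl,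
      ← Complex.ofReal_log (by norm_num), L, one_div, Real.log_inv]
    push_cast; rfl
  have hpow : (1 / ((2 : ℝ) : ℂ)) ^ (j + chi l) = (2 : ℂ)⁻¹ ^ j := by
    rw [Complex.cpow_add _ _ h2, Complex.cpow_natCast, Complex.cpow_def_of_ne_zero h2, hlog,
      neg_mul, exp_neg_L_mul_chi]
    simp
  have := hasDerivAt_laplace_kernel hj two_pos l
  rw [hpow, hlog, ← sub_eq_add_neg] at this
  exact this

/-- At `α = -Lχ_l` the factor `e^α - 1` vanishes, so only its derivative contributes: the value is
`Γ(1 + χ_l)/α`, where `Γ(1 + χ_l) = χ_l Γ(χ_l)`. -/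
lemma hasDerivAt_laplace_expDiff {l : ℤ} (hl : l ≠ 0) :
    HasDerivAt (laplace expDiff) (-(Complex.Gamma (chi l) / L)) (-(L * chi l)) := by
  have hχ := chi_ne_zero hl
  have hα0 : -(L * chi l) ≠ 0 := neg_ne_zero.2 (mul_ne_zero L_ne_zero hχ)
  have h1 := hasDerivAt_sub_div_L 1 (-(L * chi l))
  have hz : (1 : ℂ) - -(L * chi l) / L = 1 + chi l := by simpa using sub_div_L_at 1 l
  have hne : ∀ m : ℕ, (1 : ℂ) - -(L * chi l) / L ≠ -m := fun m => by
    rw [hz]; simpa using add_chi_ne_neg_natCast le_rfl l m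
  have h3 := HasDerivAt.comp (h := fun α : ℂ => 1 - α / L) (-(L * chi l))
    (hasDerivAt_Gamma_digamma hne) h1
  have h4 := (((Complex.hasDerivAt_exp (-(L * chi l))).sub_const 1).mul h3).div
    (hasDerivAt_id _) hα0
  have h5 := h4.congr_of_eventuallyEq (f₁ := laplace expDiff) (by
    filter_upwards [eventually_abs_re_lt (abs_neg_L_mul_chi_re_lt l),
      isOpen_ne.mem_nhds hα0] with α hα hne0
    have := laplace_expDiff_mul hα
    simp only [Pi.div_apply, Pi.mul_apply, Function.comp_apply, id]
    rw [eq_div_iff hne0, ← this, mul_comm])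
  refine h5.congr_deriv ?_
  simp only [Function.comp_apply, Pi.mul_apply, hz, exp_neg_L_mul_chi, id]
  rw [add_comm (1 : ℂ), Complex.Gamma_add_one _ hχ]
  have := L_ne_zero
  field_simp
  ring

/-- Differentiate the relation twice and evaluate at `0`. It is used with `G α = Γ(1 - α/L)`, where
`G 0 = 1` and `G' 0 = γ/L`. -/
lemma two_mul_deriv_eq {Λ G : ℂ → ℂ} (hΛ : AnalyticAt ℂ Λ 0) (hG : AnalyticAt ℂ G 0)
    (h : ∀ᶠ α in nhds 0, α * Λ α = (Complex.exp α - 1) * G α) :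
    2 * deriv Λ 0 = G 0 + 2 * deriv G 0 := by
  have h1 : (fun α => Λ α + α * deriv Λ α) =ᶠ[nhds 0]
      fun α => Complex.exp α * G α + (Complex.exp α - 1) * deriv G α := by
    filter_upwards [eventually_eventually_nhds.2 h, hΛ.eventually_analyticAt,
      hG.eventually_analyticAt] with α hα hΛα hGα
    have e1 := (hasDerivAt_id α).mul hΛα.differentiableAt.hasDerivAt
    have e2 := ((Complex.hasDerivAt_exp α).sub_const 1).mul hGα.differentiableAt.hasDerivAt
    have e3 := e1.unique (e2.congr_of_eventuallyEq hα)
    simpa using e3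
  have d1 := hΛ.differentiableAt.hasDerivAt.add
    ((hasDerivAt_id 0).mul hΛ.deriv.differentiableAt.hasDerivAt)
  have d2 := ((Complex.hasDerivAt_exp 0).mul hG.differentiableAt.hasDerivAt).add
    (((Complex.hasDerivAt_exp 0).sub_const 1).mul hG.deriv.differentiableAt.hasDerivAt)
  have := d1.unique (d2.congr_of_eventuallyEq h1)
  simp only [id, one_mul, zero_mul, add_zero, Complex.exp_zero, sub_self] at this
  linear_combination this

lemma expDiff_nonneg (η : ℝ) : 0 ≤ expDiff η := by
  simp only [expDiff, kernel, pow_zero, one_mul]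
  rw [sub_nonneg, Real.exp_le_exp]
  have : 0 < (2 : ℝ) ^ (-η) := by positivity
  linarith

lemma hasDerivAt_laplace_expDiff_zero :
    HasDerivAt (laplace expDiff) (1 / 2 + (Real.eulerMascheroniConstant : ℂ) / L) 0 := by
  have hre : |(0 : ℂ).re| < Real.log 2 := by simpa using log_two_pos
  have hΛ := expDecay_expDiff.analyticAt_laplace expDiff_nonneg hre
  set G : ℂ → ℂ := fun α => Complex.Gamma (1 - α / L) with hG
  have hopen : ∀ᶠ α in nhds (0 : ℂ), DifferentiableAt ℂ G α := by
    filter_upwards [eventually_abs_re_lt hre] with α hα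
    refine (Complex.differentiableAt_Gamma _ fun m h => ?_).comp α
      (hasDerivAt_sub_div_L 1 α).differentiableAt
    have h1 := congrArg Complex.re h
    rw [L, Complex.sub_re, Complex.div_ofReal_re] at h1
    simp only [Complex.one_re, Complex.neg_re, Complex.natCast_re] at h1
    have h2 : α.re / Real.log 2 < 1 := by
      rw [div_lt_one log_two_pos]; exact (le_abs_self _).trans_lt hα
    have h3 : (0 : ℝ) ≤ m := by positivity
    linarith
  have hGa : AnalyticAt ℂ G 0 := Complex.analyticAt_iff_eventually_differentiableAt.2 hopen
  have hGd : HasDerivAt G (Real.eulerMascheroniConstant / L) 0 := by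
    have h1 := hasDerivAt_sub_div_L 1 0
    have h2 : HasDerivAt Complex.Gamma (-(Real.eulerMascheroniConstant : ℂ)) (1 - 0 / L) := by
      simpa using Complex.hasDerivAt_Gamma_one
    refine (h2.comp 0 h1).congr_deriv ?_
    ring
  have h := two_mul_deriv_eq hΛ hGa
    ((eventually_abs_re_lt hre).mono fun α hα => laplace_expDiff_mul hα)
  rw [hGd.deriv] at h
  have hG0 : G 0 = 1 := by simp [hG]
  rw [hG0] at h
  refine hΛ.differentiableAt.hasDerivAt.congr_deriv ?_
  linear_combination h / 2

lemma phi_zero_eq (b : ℕ) {α : ℂ} (hα : |α.re| < Real.log 2) :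
    phi b 0 α = laplace expDiff α -
      ∑ k ∈ Finset.range b, ((k + 1).factorial : ℂ)⁻¹ * laplace (kernel (k + 1) 2) α := by
  have h : ∀ k ∈ Finset.range b, ExpDecay fun η =>
      ((k + 1).factorial : ℝ)⁻¹ * kernel (k + 1) 2 η := fun k _ =>
    (expDecay_kernel (by omega) one_le_two).const_mul _
  rw [phi_eq_laplace, show f b 0 = _ from funext (f_zero_eq b),
    laplace_sub expDecay_expDiff (ExpDecay.sum h) hα, laplace_sum h hα]
  simp only [laplace_const_mul]
  push_cast
  rfl

lemma phi_pos_eq (b : ℕ) {r : ℕ} (hr : 1 ≤ r) {α : ℂ} (hα : |α.re| < Real.log 2) :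
    phi b r α = (r.factorial : ℂ)⁻¹ * (laplace (kernel r 1) α -
      ∑ k ∈ Finset.range (b - r + 1), (k.factorial : ℂ)⁻¹ * laplace (kernel (r + k) 2) α) := by
  have h : ∀ k ∈ Finset.range (b - r + 1), ExpDecay fun η =>
      (k.factorial : ℝ)⁻¹ * kernel (r + k) 2 η := fun k _ =>
    (expDecay_kernel (by omega) one_le_two).const_mul _
  have hf : f b r = fun η => (r.factorial : ℝ)⁻¹ * (kernel r 1 η -
      ∑ k ∈ Finset.range (b - r + 1), (k.factorial : ℝ)⁻¹ * kernel (r + k) 2 η) := by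
    funext η
    rw [f_eq_kernel, div_eq_inv_mul]
    congr 2
    exact Finset.sum_congr rfl fun k _ => by rw [div_eq_inv_mul]
  rw [phi_eq_laplace, hf, laplace_const_mul, laplace_sub (expDecay_kernel hr le_rfl)
    (ExpDecay.sum h) hα, laplace_sum h hα]
  simp only [laplace_const_mul]
  push_cast
  rfl

lemma deriv_phi_pos (b : ℕ) {r : ℕ} (hr : 1 ≤ r) (l : ℤ) :
    deriv (phi b r) (-(L * chi l)) =
      -(Complex.digamma ((r : ℂ) + chi l) * Complex.Gamma ((r : ℂ) + chi l) /
          (L ^ 2 * Complex.Gamma ((r : ℂ) + 1))) +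
        ∑ k ∈ Finset.range (b - r + 1),
          (Complex.digamma ((r : ℂ) + k + chi l) - L) * (2 : ℂ)⁻¹ ^ (r + k) *
            Complex.Gamma ((r : ℂ) + k + chi l) /
              (L ^ 2 * Complex.Gamma ((r : ℂ) + 1) * Complex.Gamma ((k : ℂ) + 1)) := by
  have h1 := hasDerivAt_laplace_kernel_one hr l
  have h2 := HasDerivAt.fun_sum (u := Finset.range (b - r + 1)) fun k _ =>
    (hasDerivAt_laplace_kernel_two (j := r + k) (by omega) l).const_mul ((k.factorial : ℂ)⁻¹)
  have h3 := ((h1.sub h2).const_mul ((r.factorial : ℂ)⁻¹)).congr_of_eventuallyEq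
    ((eventually_abs_re_lt (abs_neg_L_mul_chi_re_lt l)).mono fun α hα => phi_pos_eq b hr hα)
  rw [h3.deriv, mul_sub, Finset.mul_sum, sub_eq_add_neg, ← Finset.sum_neg_distrib]
  have hL := L_ne_zero
  congr 1
  · rw [Complex.Gamma_nat_eq_factorial]
    field_simp
  · refine Finset.sum_congr rfl fun k _ => ?_
    rw [Complex.Gamma_nat_eq_factorial, Complex.Gamma_nat_eq_factorial]
    push_cast
    field_simp

/-- `E` is left free because the contribution of `expDiff` has different forms at `l = 0` and at `l
≠ 0`. -/
lemma deriv_phi_zero (b : ℕ) {l : ℤ} {E : ℂ}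
    (hE : HasDerivAt (laplace expDiff) E (-(L * chi l))) :
    deriv (phi b 0) (-(L * chi l)) = E + ∑ k ∈ Finset.range b,
      (2 : ℂ)⁻¹ ^ (k + 1) * (Complex.digamma ((k + 1 : ℕ) + chi l) - L) *
        Complex.Gamma ((k + 1 : ℕ) + chi l) / (L ^ 2 * (k + 1).factorial) := by
  have h2 := HasDerivAt.fun_sum (u := Finset.range b) fun k _ =>
    (hasDerivAt_laplace_kernel_two (j := k + 1) (by omega) l).const_mul
      (((k + 1).factorial : ℂ)⁻¹)
  have h3 := (hE.sub h2).congr_of_eventuallyEq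
    ((eventually_abs_re_lt (abs_neg_L_mul_chi_re_lt l)).mono fun α hα => phi_zero_eq b hα)
  rw [h3.deriv, sub_eq_add_neg, ← Finset.sum_neg_distrib]
  have hL := L_ne_zero
  congr 1
  refine Finset.sum_congr rfl fun k _ => ?_
  have : ((k + 1).factorial : ℂ) ≠ 0 := Nat.cast_ne_zero.2 (Nat.factorial_ne_zero _)
  field_simp

lemma neg_L_mul_chi_zero : -(L * chi 0) = 0 := by simp [chi]

lemma chi_zero : chi 0 = 0 := by simp [chi]

lemma mTilde_one_pos (b : ℕ) {r : ℕ} (hr : 1 ≤ r) :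
    mTilde b 1 r = -(Complex.digamma r / (L ^ 2 * r)) +
      ∑ k ∈ Finset.range (b - r + 1),
        (Complex.digamma ((r : ℂ) + k) - L) * (2 : ℂ)⁻¹ ^ (r + k) * Complex.Gamma ((r : ℂ) + k) /
          (L ^ 2 * Complex.Gamma ((r : ℂ) + 1) * Complex.Gamma ((k : ℂ) + 1)) := by
  have h := deriv_phi_pos b hr 0
  rw [neg_L_mul_chi_zero, chi_zero] at h
  simp only [add_zero] at h
  rw [mTilde, iteratedDeriv_one, h]
  congr 2
  have hr0 : (r : ℂ) ≠ 0 := Nat.cast_ne_zero.2 (by omega)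
  have hΓ : Complex.Gamma r ≠ 0 := by
    refine Complex.Gamma_ne_zero fun m hm => ?_
    simpa [chi_zero] using add_chi_ne_neg_natCast hr 0 m (by simpa [chi_zero] using hm)
  rw [Complex.Gamma_add_one _ hr0]
  have := L_ne_zero
  field_simp

lemma mTilde_one_zero (b : ℕ) :
    mTilde b 1 0 = 1 / 2 + (Real.eulerMascheroniConstant : ℂ) / L +
      ∑ k ∈ Finset.Icc 1 b,
        (Complex.digamma k - L) * (2 : ℂ)⁻¹ ^ k / (k * L ^ 2) := by
  have h := deriv_phi_zero b (l := 0) (E := 1 / 2 + (Real.eulerMascheroniConstant : ℂ) / L)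
    (by rw [neg_L_mul_chi_zero]; exact hasDerivAt_laplace_expDiff_zero)
  rw [neg_L_mul_chi_zero, chi_zero] at h
  rw [mTilde, iteratedDeriv_one, h]
  congr 1
  rw [← Finset.Ico_succ_right_eq_Icc, Finset.sum_Ico_eq_sum_range]
  refine Finset.sum_congr (by simp) fun k _ => ?_
  have hΓ : Complex.Gamma ((k + 1 : ℕ) : ℂ) = k.factorial := by
    push_cast; exact Complex.Gamma_nat_eq_factorial k
  simp only [add_zero]
  rw [hΓ, Nat.factorial_succ, add_comm 1 k]
  have h1 : (k.factorial : ℂ) ≠ 0 := Nat.cast_ne_zero.2 (Nat.factorial_ne_zero _)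
  have h2 : ((k : ℂ) + 1) ≠ 0 := by exact_mod_cast Nat.succ_ne_zero k
  have := L_ne_zero
  push_cast
  field_simp

lemma wTerm_one_pos (b : ℕ) {r : ℕ} (hr : 1 ≤ r) (n : ℕ) (l : ℤ) :
    wTerm b 1 r n l =
      (-(Complex.digamma ((r : ℂ) + chi l) * Complex.Gamma ((r : ℂ) + chi l) /
          (L ^ 2 * Complex.Gamma ((r : ℂ) + 1))) +
        ∑ k ∈ Finset.range (b - r + 1),
          (Complex.digamma ((r : ℂ) + k + chi l) - L) * (2 : ℂ)⁻¹ ^ (r + k) *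
            Complex.Gamma ((r : ℂ) + k + chi l) /
              (L ^ 2 * Complex.Gamma ((r : ℂ) + 1) * Complex.Gamma ((k : ℂ) + 1))) *
        wave l n := by
  rw [wTerm, iteratedDeriv_one, deriv_phi_pos b hr l]

lemma wTerm_one_zero (b n : ℕ) {l : ℤ} (hl : l ≠ 0) :
    wTerm b 1 0 n l =
      (-(Complex.digamma (chi l) * Complex.Gamma (chi l) / L ^ 2) +
        ∑ k ∈ Finset.range (b + 1),
          Complex.Gamma ((k : ℂ) + chi l) / (L ^ 2 * (k.factorial : ℂ) * 2 ^ k) *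
            (Complex.digamma ((k : ℂ) + chi l) - L)) * wave l n := by
  rw [wTerm, iteratedDeriv_one, deriv_phi_zero b (hasDerivAt_laplace_expDiff hl),
    Finset.sum_range_succ']
  congr 1
  have := L_ne_zero
  rw [add_comm (Finset.sum _ _), ← add_assoc]
  congr 1
  -- The leading digamma term cancels against the `k = 0` summand, leaving `-Γ(χ_l)/L`, the
  -- contribution of `expDiff`.
  · simp only [Nat.cast_zero, zero_add, Nat.factorial_zero, Nat.cast_one, mul_one, pow_zero]
    field_simp
    ring
  · refine Finset.sum_congr rfl fun k _ => ?_
    rw [inv_pow]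
    have h1 : ((k + 1).factorial : ℂ) ≠ 0 := Nat.cast_ne_zero.2 (Nat.factorial_ne_zero _)
    field_simp

/-! ### Poisson approximation of the binomial terms -/

lemma exp_sub_one_le (y : ℝ) : Real.exp y - 1 ≤ y * Real.exp y := by
  have h1 := Real.add_one_le_exp (-y)
  have h2 : Real.exp (-y) * Real.exp y = 1 := by rw [← Real.exp_add]; simp
  nlinarith [Real.exp_pos y]

/-- Comparison of `(1 - x) ^ (n - j)` with `exp (-(n x))`. -/
lemma abs_one_sub_pow_sub_exp_le {n j : ℕ} (hn : j + 1 ≤ n) {x : ℝ} (hx0 : 0 ≤ x) (hx1 : x ≤ 1) :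
    |(1 - x) ^ (n - j) - Real.exp (-(n * x))| ≤
      (n * x ^ 2 * Real.exp (j + 1) + x * j * Real.exp j) * Real.exp (-(n * x)) := by
  obtain ⟨m, rfl⟩ := Nat.exists_eq_add_of_le' hn
  have e0 : m + (j + 1) - j = m + 1 := by omega
  rw [e0]
  push_cast
  have h1 : |(1 - x) ^ (m + 1) - Real.exp (-x) ^ (m + 1)| ≤
      x ^ 2 * (m + 1) * Real.exp (-x) ^ m := by
    refine (abs_pow_sub_pow_le _ _ _).trans ?_
    have h3 : |1 - x - Real.exp (-x)| ≤ x ^ 2 := by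
      have := Real.abs_exp_sub_one_sub_id_le (x := -x) (by rwa [abs_neg, abs_of_nonneg hx0])
      rw [show 1 - x - Real.exp (-x) = -(Real.exp (-x) - 1 - -x) by ring, abs_neg]
      simpa only [neg_sq] using this
    have h4 : max |1 - x| |Real.exp (-x)| = Real.exp (-x) := by
      rw [abs_of_nonneg (by linarith), abs_of_pos (Real.exp_pos _), max_eq_right]
      have := Real.add_one_le_exp (-x)
      linarith
    rw [h4, Nat.add_sub_cancel]
    push_cast
    gcongr
  -- Here `n = m + j + 1`; the missing `j + 1` factors `e^{-x}` cost at most `e^{j+1}`, because `x ≤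
  -- 1`.
  have h2 : Real.exp (-x) ^ m = Real.exp (x * (j + 1)) * Real.exp (-((m + (j + 1)) * x)) := by
    rw [← Real.exp_nat_mul, ← Real.exp_add]
    ring_nf
  have h3 : Real.exp (-x) ^ (m + 1) = Real.exp (x * j) * Real.exp (-((m + (j + 1)) * x)) := by
    rw [← Real.exp_nat_mul, ← Real.exp_add]
    push_cast
    ring_nf
  have hj : (0 : ℝ) ≤ j := by positivity
  have h4 : Real.exp (x * (j + 1)) ≤ Real.exp (j + 1) := Real.exp_le_exp.2 (by nlinarith)
  have h5 : Real.exp (x * j) ≤ Real.exp j := Real.exp_le_exp.2 (by nlinarith)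
  have h6 : |Real.exp (-x) ^ (m + 1) - Real.exp (-((m + (j + 1)) * x))| ≤
      x * j * Real.exp j * Real.exp (-((m + (j + 1)) * x)) := by
    rw [h3, ← sub_one_mul, abs_mul, abs_of_pos (Real.exp_pos (-((m + (j + 1)) * x)))]
    gcongr
    rw [abs_of_nonneg (sub_nonneg.2 (Real.one_le_exp (by positivity)))]
    exact (exp_sub_one_le _).trans (by gcongr)
  calc |(1 - x) ^ (m + 1) - Real.exp (-((m + (j + 1)) * x))|
      ≤ |(1 - x) ^ (m + 1) - Real.exp (-x) ^ (m + 1)| +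
        |Real.exp (-x) ^ (m + 1) - Real.exp (-((m + (j + 1)) * x))| := abs_sub_le _ _ _
    _ ≤ x ^ 2 * (m + 1) * Real.exp (-x) ^ m +
        x * j * Real.exp j * Real.exp (-((m + (j + 1)) * x)) := add_le_add h1 h6
    _ ≤ x ^ 2 * (m + (j + 1)) * (Real.exp (j + 1) * Real.exp (-((m + (j + 1)) * x))) +
        x * j * Real.exp j * Real.exp (-((m + (j + 1)) * x)) := by
        rw [h2]
        gcongr
        linarith
    _ = _ := by ring

/-- `(n - j)^j ≤ n.descFactorial j ≤ n^j`, and Bernoulli's inequality bounds `(1 - j/n)^j` from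
below. -/
lemma abs_descFactorial_div_pow_sub_one_le {n j : ℕ} (hn : j + 1 ≤ n) :
    |(n.descFactorial j : ℝ) / (n : ℝ) ^ j - 1| ≤ (j : ℝ) ^ 2 / n := by
  have hn0 : (0 : ℝ) < n := by exact_mod_cast (show 0 < n by omega)
  have hp : (0 : ℝ) < (n : ℝ) ^ j := by positivity
  have h1 : (n.descFactorial j : ℝ) / (n : ℝ) ^ j ≤ 1 := by
    rw [div_le_one hp]; exact_mod_cast Nat.descFactorial_le_pow n j
  have h2 : ((n : ℝ) - j) ^ j ≤ n.descFactorial j := by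
    have h3 : (n - j) ^ j ≤ n.descFactorial j :=
      (Nat.pow_le_pow_left (by omega) j).trans (Nat.pow_sub_le_descFactorial n j)
    have h4 : ((n - j : ℕ) : ℝ) = (n : ℝ) - j := Nat.cast_sub (by omega)
    rw [← h4]
    exact_mod_cast h3
  have h5 : 1 - (j : ℝ) ^ 2 / n ≤ (n.descFactorial j : ℝ) / (n : ℝ) ^ j := by
    have hjn : (j : ℝ) / n ≤ 1 := by
      rw [div_le_one hn0]; exact_mod_cast (show j ≤ n by omega)
    have h6 := one_add_mul_le_pow (a := -((j : ℝ) / n)) (by linarith) j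
    have h7 : (1 + -((j : ℝ) / n)) ^ j = ((n : ℝ) - j) ^ j / (n : ℝ) ^ j := by
      rw [← div_pow]
      congr 1
      field_simp
      ring
    calc 1 - (j : ℝ) ^ 2 / n = 1 + j * -((j : ℝ) / n) := by ring
      _ ≤ _ := h6
      _ = ((n : ℝ) - j) ^ j / (n : ℝ) ^ j := h7
      _ ≤ _ := by gcongr
  rw [abs_le]
  constructor
  · linarith
  · have : 0 ≤ (j : ℝ) ^ 2 / n := by positivity
    linarith

/-- The error is `u^j e^{-u} / n` times a combination of `u²`, `u` and `1`; `e^{-u}` times a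
positive power of `u` is `O(2^{-|η|})`. The hypothesis on `u/n` ensures `c u/n ≤ 1`. -/
lemma exists_abs_binomTerm_sub_kernel_le (j : ℕ) {c : ℝ} (hc1 : 1 ≤ c) (hc2 : c ≤ 2) :
    ∃ K : ℝ, 0 ≤ K ∧ ∀ n : ℕ, j + 1 ≤ n → ∀ η : ℝ, (2 : ℝ) ^ (-η) / n ≤ 1 / 2 →
      |binomTerm n j c ((2 : ℝ) ^ (-η) / n) - kernel j c η| ≤ K / n * (2 : ℝ) ^ (-|η|) := by
  refine ⟨4 * Real.exp (j + 1) * (j + 2 + 1).factorial + 2 * j * Real.exp j *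
    (j + 1 + 1).factorial + j ^ 2 * (j + 1).factorial, by positivity, fun n hn η hq => ?_⟩
  have b1 := pow_mul_exp_neg_le_two_rpow (show 1 ≤ j + 2 by omega) η
  have b2 := pow_mul_exp_neg_le_two_rpow (show 1 ≤ j + 1 by omega) η
  -- The only term without an extra factor `u` carries `j²`, so `j = 0`, where `u^j e^{-u}` does not
  -- decay, does no harm.
  have b3 : (j : ℝ) ^ 2 * (((2 : ℝ) ^ (-η)) ^ j * Real.exp (-(2 : ℝ) ^ (-η))) ≤
      j ^ 2 * ((j + 1).factorial * (2 : ℝ) ^ (-|η|)) := by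
    rcases Nat.eq_zero_or_pos j with rfl | hj
    · simp
    · exact mul_le_mul_of_nonneg_left (pow_mul_exp_neg_le_two_rpow hj η) (by positivity)
  rw [kernel]
  set u := (2 : ℝ) ^ (-η) with hu
  set w := (2 : ℝ) ^ (-|η|) with hw
  have hu0 : 0 < u := by positivity
  have hn0 : (0 : ℝ) < n := by exact_mod_cast (show 0 < n by omega)
  set ρ := (n.descFactorial j : ℝ) / (n : ℝ) ^ j with hρ
  have hρ0 : 0 ≤ ρ := by positivity
  have hρ1 : ρ ≤ 1 := by
    rw [hρ, div_le_one (by positivity)]; exact_mod_cast Nat.descFactorial_le_pow n j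
  have hρd := abs_descFactorial_div_pow_sub_one_le hn
  rw [← hρ] at hρd
  have hT : binomTerm n j c (u / n) = ρ * u ^ j * (1 - c * (u / n)) ^ (n - j) := by
    rw [binomTerm, div_pow, hρ]; ring
  have hx0 : 0 ≤ c * (u / n) := by positivity
  have hx1 : c * (u / n) ≤ 1 := by
    have : 0 ≤ u / n := by positivity
    nlinarith
  have hP := abs_one_sub_pow_sub_exp_le hn hx0 hx1
  rw [show (n : ℝ) * (c * (u / n)) = c * u by field_simp] at hP
  have hexp : Real.exp (-(c * u)) ≤ Real.exp (-u) := Real.exp_le_exp.2 (by nlinarith)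
  have hP' : |(1 - c * (u / n)) ^ (n - j) - Real.exp (-(c * u))| ≤
      (4 * Real.exp (j + 1) * u ^ 2 + 2 * j * Real.exp j * u) / n * Real.exp (-u) := by
    refine hP.trans ?_
    have e1 : (n : ℝ) * (c * (u / n)) ^ 2 * Real.exp (j + 1) + c * (u / n) * j * Real.exp j =
        (c ^ 2 * Real.exp (j + 1) * u ^ 2 + c * j * Real.exp j * u) / n := by
      field_simp
    rw [e1]
    have hc4 : c ^ 2 ≤ 4 := by nlinarith
    gcongr
  have hsplit : ρ * u ^ j * (1 - c * (u / n)) ^ (n - j) - u ^ j * Real.exp (-(c * u)) =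
      ρ * u ^ j * ((1 - c * (u / n)) ^ (n - j) - Real.exp (-(c * u))) +
        (ρ - 1) * (u ^ j * Real.exp (-(c * u))) := by ring
  rw [hT, hsplit]
  calc _ ≤ |ρ * u ^ j * ((1 - c * (u / n)) ^ (n - j) - Real.exp (-(c * u)))| +
        |(ρ - 1) * (u ^ j * Real.exp (-(c * u)))| := abs_add_le _ _
    _ = ρ * u ^ j * |(1 - c * (u / n)) ^ (n - j) - Real.exp (-(c * u))| +
        |ρ - 1| * (u ^ j * Real.exp (-(c * u))) := by
        rw [abs_mul (ρ * u ^ j), abs_mul (ρ - 1), abs_of_nonneg (by positivity : 0 ≤ ρ * u ^ j),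
          abs_of_nonneg (by positivity : 0 ≤ u ^ j * Real.exp (-(c * u)))]
    _ ≤ 1 * u ^ j * ((4 * Real.exp (j + 1) * u ^ 2 + 2 * j * Real.exp j * u) / n * Real.exp (-u)) +
        j ^ 2 / n * (u ^ j * Real.exp (-u)) := by gcongr
    _ = (4 * Real.exp (j + 1) * (u ^ (j + 2) * Real.exp (-u)) +
        2 * j * Real.exp j * (u ^ (j + 1) * Real.exp (-u)) +
        j ^ 2 * (u ^ j * Real.exp (-u))) / n := by ring
    _ ≤ (4 * Real.exp (j + 1) * ((j + 2 + 1).factorial * w) +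
        2 * j * Real.exp j * ((j + 1 + 1).factorial * w) +
        j ^ 2 * ((j + 1).factorial * w)) / n := by gcongr
    _ = _ := by ring

lemma exists_abs_jointProb_sub_f_le (b r : ℕ) (hr : r ≤ b) :
    ∃ K : ℝ, 0 ≤ K ∧ ∀ n : ℕ, b + 1 ≤ n → ∀ η : ℝ, (2 : ℝ) ^ (-η) / n ≤ 1 / 2 →
      |jointProb n b r ((2 : ℝ) ^ (-η) / n) - f b r η| ≤ K / n * (2 : ℝ) ^ (-|η|) := by
  obtain ⟨K₁, hK₁0, hK₁⟩ := exists_abs_binomTerm_sub_kernel_le r le_rfl one_le_two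
  choose K₂ hK₂0 hK₂ using fun k : ℕ =>
    exists_abs_binomTerm_sub_kernel_le (r + k) one_le_two le_rfl
  refine ⟨K₁ + ∑ k ∈ Finset.range (b - r + 1), K₂ k,
    add_nonneg hK₁0 (Finset.sum_nonneg fun k _ => hK₂0 k), fun n hn η hq => ?_⟩
  set w := (2 : ℝ) ^ (-|η|) with hw
  have hw0 : 0 < w := by positivity
  have hfac : ∀ m : ℕ, (1 : ℝ) ≤ m.factorial := fun m => by
    exact_mod_cast Nat.succ_le_of_lt m.factorial_pos
  have h1 := hK₁ n (by omega) η hq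
  have h2 : ∀ k ∈ Finset.range (b - r + 1),
      |binomTerm n (r + k) 2 ((2 : ℝ) ^ (-η) / n) / k.factorial - kernel (r + k) 2 η / k.factorial|
        ≤ K₂ k / n * w := by
    intro k hk
    rw [← sub_div, abs_div, abs_of_pos (by linarith [hfac k] : (0 : ℝ) < k.factorial)]
    refine (div_le_self (abs_nonneg _) (hfac k)).trans ?_
    rw [Finset.mem_range] at hk
    exact hK₂ k n (by omega) η hq
  rw [jointProb, f_eq_kernel, ← sub_div, abs_div,
    abs_of_pos (by linarith [hfac r] : (0 : ℝ) < r.factorial)]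
  refine (div_le_self (abs_nonneg _) (hfac r)).trans ?_
  rw [sub_sub_sub_comm, ← Finset.sum_sub_distrib]
  refine (abs_sub _ _).trans ?_
  rw [add_div, add_mul, Finset.sum_div, Finset.sum_mul]
  exact add_le_add h1 ((Finset.abs_sum_le_sum_abs _ _).trans (Finset.sum_le_sum h2))

lemma f_le_kernel (b r : ℕ) (η : ℝ) : f b r η ≤ kernel r 1 η := by
  have hfac : (1 : ℝ) ≤ r.factorial := by exact_mod_cast Nat.succ_le_of_lt r.factorial_pos
  have h1 : 0 ≤ ∑ k ∈ Finset.range (b - r + 1), kernel (r + k) 2 η / k.factorial :=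
    Finset.sum_nonneg fun k _ => div_nonneg (kernel_nonneg _ _ _) (by positivity)
  rw [f_eq_kernel]
  calc _ ≤ kernel r 1 η / r.factorial := by gcongr; linarith
    _ ≤ _ := div_le_self (kernel_nonneg _ _ _) hfac

/-- Handles depths `d ≤ 0`, where `jointProbInt` is zero: with `u ≥ n`, `f ≤ u^r e^{-u} ≤
(r+2)!/u²`, and one factor `1/u` is at most `1/n` while the other is `2^{-|η|}`. -/
lemma abs_f_le_of_le_two_rpow (b r : ℕ) {n : ℕ} (hn : 1 ≤ n) {η : ℝ}
    (hη : (n : ℝ) ≤ (2 : ℝ) ^ (-η)) :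
    |f b r η| ≤ (r + 2).factorial / n * (2 : ℝ) ^ (-|η|) := by
  have hn1 : (1 : ℝ) ≤ n := by exact_mod_cast hn
  have hη0 : η ≤ 0 := by
    by_contra h
    have := Real.rpow_lt_one_of_one_lt_of_neg (x := 2) (by norm_num) (show -η < 0 by linarith)
    linarith
  rw [abs_of_nonneg (f_nonneg b r η), abs_of_nonpos hη0, neg_neg]
  refine (f_le_kernel b r η).trans ?_
  have h1 := pow_mul_exp_neg_le (r + 2) (u := (2 : ℝ) ^ (-η)) (by positivity)
  have h3 : (2 : ℝ) ^ η = ((2 : ℝ) ^ (-η))⁻¹ := by rw [Real.rpow_neg (by norm_num), inv_inv]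
  rw [kernel, one_mul, h3]
  set u := (2 : ℝ) ^ (-η) with hu
  have hu0 : 0 < u := by positivity
  calc u ^ r * Real.exp (-u) = (u ^ (r + 2) * Real.exp (-u)) / u * u⁻¹ := by
        field_simp
        ring
    _ ≤ (r + 2).factorial / n * u⁻¹ := by gcongr

/-- `P(R = r, D = d)`, extended by zero to `d ≤ 0`. -/
def jointProbInt (n b r : ℕ) (d : ℤ) : ℝ :=
  if 1 ≤ d then jointProb n b r ((2 : ℝ) ^ (-(d : ℝ))) else 0

lemma two_rpow_neg_sub_lg {n : ℕ} (hn : 1 ≤ n) (d : ℝ) :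
    (2 : ℝ) ^ (-(d - lg n)) = n * (2 : ℝ) ^ (-d) := by
  have hn0 : (0 : ℝ) < n := by exact_mod_cast hn
  rw [show -(d - lg n) = lg n + -d by ring, Real.rpow_add (by norm_num), lg,
    Real.rpow_logb (by norm_num) (by norm_num) hn0]

lemma exists_abs_jointProbInt_sub_f_le (b r : ℕ) (hr : r ≤ b) :
    ∃ K : ℝ, 0 ≤ K ∧ ∀ n : ℕ, b + 1 ≤ n → ∀ d : ℤ,
      |jointProbInt n b r d - f b r (d - lg n)| ≤ K / n * (2 : ℝ) ^ (-|(d : ℝ) - lg n|) := by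
  obtain ⟨K, hK0, hK⟩ := exists_abs_jointProb_sub_f_le b r hr
  refine ⟨K + (r + 2).factorial, by positivity, fun n hn d => ?_⟩
  have hn0 : (0 : ℝ) < n := by exact_mod_cast (show 0 < n by omega)
  have hu := two_rpow_neg_sub_lg (show 1 ≤ n by omega) d
  rw [jointProbInt]
  split_ifs with hd
  · have hd' : (1 : ℝ) ≤ d := by exact_mod_cast hd
    have hq : (2 : ℝ) ^ (-((d : ℝ) - lg n)) / n = (2 : ℝ) ^ (-(d : ℝ)) := by
      rw [hu]; field_simp
    have hq2 : (2 : ℝ) ^ (-(d : ℝ)) ≤ 1 / 2 := by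
      calc (2 : ℝ) ^ (-(d : ℝ)) ≤ (2 : ℝ) ^ (-1 : ℝ) :=
            Real.rpow_le_rpow_of_exponent_le (by norm_num) (by linarith)
        _ = 1 / 2 := by rw [Real.rpow_neg_one]; norm_num
    have := hK n hn (d - lg n) (hq ▸ hq2)
    rw [hq] at this
    refine this.trans ?_
    gcongr
    linarith [(by positivity : (0 : ℝ) ≤ (r + 2).factorial)]
  · have hd' : (d : ℝ) ≤ 0 := by exact_mod_cast (show d ≤ 0 by omega)
    have h1 : (1 : ℝ) ≤ (2 : ℝ) ^ (-(d : ℝ)) := Real.one_le_rpow (by norm_num) (by linarith)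
    rw [zero_sub, abs_neg]
    refine (abs_f_le_of_le_two_rpow b r (show 1 ≤ n by omega) ?_).trans ?_
    · rw [hu]; exact le_mul_of_one_le_right hn0.le h1
    · gcongr
      linarith

/-! ### Sums over the integers -/

/-- Uniformity in `x`: shifting the index by `⌊x⌋` leaves only the fractional part, which changes
`|m|` by at most `1` and the exponential by at most a factor `2`. -/
lemma exists_tsum_pow_mul_two_rpow_le (k : ℕ) :
    ∃ M : ℝ, ∀ x : ℝ, Summable (fun d : ℤ => |(d : ℝ) - x| ^ k * (2 : ℝ) ^ (-|(d : ℝ) - x|)) ∧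
      ∑' d : ℤ, |(d : ℝ) - x| ^ k * (2 : ℝ) ^ (-|(d : ℝ) - x|) ≤ M := by
  set g : ℤ → ℝ := fun m => (|(m : ℝ)| + 1) ^ k * (2 * (2 : ℝ) ^ (-|(m : ℝ)|)) with hg
  have hg_nat : Summable fun m : ℕ => g m := by
    refine ((summable_pow_mul_geometric 1 k).mul_left 2).congr fun m => ?_
    simp only [hg, Int.cast_natCast, Nat.abs_cast]
    rw [Real.rpow_neg (by norm_num), Real.rpow_natCast, inv_pow]
    ring
  have hgs : Summable g := by
    refine Summable.of_nat_of_neg hg_nat (hg_nat.congr fun m => ?_)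
    simp [hg]
  refine ⟨∑' m, g m, fun x => ?_⟩
  set F : ℤ → ℝ := fun d => |(d : ℝ) - x| ^ k * (2 : ℝ) ^ (-|(d : ℝ) - x|) with hF
  have hle : ∀ m : ℤ, F (m + ⌊x⌋) ≤ g m := by
    intro m
    have h0 := Int.fract_nonneg x
    have h1 := (Int.fract_lt_one x).le
    have e : ((m + ⌊x⌋ : ℤ) : ℝ) - x = m - Int.fract x := by
      rw [Int.fract]; push_cast; ring
    have a1 : |(m : ℝ) - Int.fract x| ≤ |(m : ℝ)| + 1 :=
      (abs_sub _ _).trans (by rw [abs_of_nonneg h0]; linarith)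
    have a2 : |(m : ℝ)| - 1 ≤ |(m : ℝ) - Int.fract x| := by
      have := abs_sub_abs_le_abs_sub (m : ℝ) (Int.fract x)
      rw [abs_of_nonneg h0] at this
      linarith
    simp only [hF, hg, e]
    gcongr
    rw [show 2 * (2 : ℝ) ^ (-|(m : ℝ)|) = (2 : ℝ) ^ (1 + -|(m : ℝ)|) by
      rw [Real.rpow_add (by norm_num), Real.rpow_one]]
    exact Real.rpow_le_rpow_of_exponent_le (by norm_num) (by linarith)
  have hF0 : ∀ d, 0 ≤ F d := fun d => by positivity
  have hs : Summable fun m : ℤ => F (m + ⌊x⌋) :=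
    Summable.of_nonneg_of_le (fun m => hF0 _) hle hgs
  refine ⟨(Equiv.addRight ⌊x⌋).summable_iff.1 hs, ?_⟩
  rw [← (Equiv.addRight ⌊x⌋).tsum_eq F]
  exact hs.tsum_le_tsum hle hgs

lemma hasSum_momentD_int {n b r : ℕ} (hb : b < n) (hr : r ≤ b) (S : List (Fin n))
    (hS : ∀ x, x ∈ S) (k : ℕ) :
    HasSum (fun d : ℤ => jointProbInt n b r d * ((d : ℝ) - lg n) ^ k) (momentD b S k r) := by
  have hinj : Function.Injective fun d : ℕ => (d : ℤ) + 1 := fun a c h => by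
    simpa using h
  rw [← hinj.hasSum_iff]
  · refine (hasSum_momentD hb hr S hS k).congr_fun fun d => ?_
    simp only [Function.comp_apply, jointProbInt]
    rw [if_pos (by omega)]
    push_cast
    rw [Real.rpow_neg (by norm_num), ← Nat.cast_succ, Real.rpow_natCast, inv_pow]
  · intro d hd
    rw [jointProbInt, if_neg, zero_mul]
    intro h1
    exact hd ⟨(d - 1).toNat, by simp only; omega⟩

/-- The pointwise error `K/n * 2^{-|η|}` is summed against `|η|^k`; the constant depends neither on
`n` nor on the stream. -/
lemma exists_abs_momentD_sub_tsum_le (b r : ℕ) (hr : r ≤ b) (k : ℕ) :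
    ∃ K : ℝ, ∀ n : ℕ, b + 1 ≤ n → ∀ S : List (Fin n), (∀ x, x ∈ S) →
      |momentD b S k r - ∑' d : ℤ, ((d : ℝ) - lg n) ^ k * f b r (d - lg n)| ≤ K / n := by
  obtain ⟨K, hK0, hK⟩ := exists_abs_jointProbInt_sub_f_le b r hr
  obtain ⟨M, hM⟩ := exists_tsum_pow_mul_two_rpow_le k
  obtain ⟨C, hC⟩ := (expDecay_f b r).bound
  refine ⟨K * M, fun n hn S hS => ?_⟩
  have hn0 : (0 : ℝ) < n := by exact_mod_cast (show 0 < n by omega)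
  obtain ⟨hs, hle⟩ := hM (lg n)
  have h1 := hasSum_momentD_int (show b < n by omega) hr S hS k
  have h2 : Summable fun d : ℤ => ((d : ℝ) - lg n) ^ k * f b r (d - lg n) := by
    refine (hs.mul_left C).of_norm_bounded fun d => ?_
    rw [norm_mul, norm_pow, Real.norm_eq_abs, Real.norm_eq_abs, mul_left_comm]
    exact mul_le_mul_of_nonneg_left (hC _) (by positivity)
  have h3 := h1.sub h2.hasSum
  have h4 := tsum_of_norm_bounded (hs.hasSum.mul_left (K / n)) (f := fun d : ℤ =>
    jointProbInt n b r d * ((d : ℝ) - lg n) ^ k - ((d : ℝ) - lg n) ^ k * f b r (d - lg n))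
    fun d => by
      rw [show jointProbInt n b r d * ((d : ℝ) - lg n) ^ k -
        ((d : ℝ) - lg n) ^ k * f b r (d - lg n) =
        ((d : ℝ) - lg n) ^ k * (jointProbInt n b r d - f b r (d - lg n)) by ring,
        norm_mul, norm_pow, Real.norm_eq_abs, Real.norm_eq_abs, mul_left_comm]
      exact mul_le_mul_of_nonneg_left (hK n hn d) (by positivity)
  rw [h3.tsum_eq, Real.norm_eq_abs] at h4
  refine h4.trans ?_
  calc K / n * _ ≤ K / n * M := by gcongr
    _ = _ := by ring

/-! ### The Fourier series -/

/-- As `-Lχ_l = -2πil`, the `k`-th derivative of the Laplace transform there is the Fourier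
transform of `η^k f(r, η)` at `l`. -/
lemma wTerm_eq (b k r n : ℕ) (l : ℤ) :
    wTerm b k r n l = FourierTransform.fourier ((expDecay_f b r).momentSchwartz k) (l : ℝ) *
      Complex.exp (-(2 * l * Real.pi * Complex.I * (lg n : ℝ))) := by
  rw [wTerm, wave, (expDecay_f b r).fourier_momentSchwartz, phi_eq_laplace,
    (expDecay_f b r).iteratedDeriv_laplace (f_nonneg b r) k (abs_neg_L_mul_chi_re_lt l), L_mul_chi]
  simp

lemma summable_wTerm (b k r n : ℕ) : Summable (wTerm b k r n) := by
  refine ((expDecay_f b r).summable_fourier k).of_norm_bounded fun l => ?_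
  rw [wTerm_eq, norm_mul, Complex.norm_exp]
  simp

lemma mTilde_eq_wTerm (b k r n : ℕ) : mTilde b k r = wTerm b k r n 0 := by
  rw [mTilde, wTerm, neg_L_mul_chi_zero, wave]
  simp

lemma tsum_eq_mTilde_add_wTilde (b k r n : ℕ) :
    ((∑' d : ℤ, ((d : ℝ) - lg n) ^ k * f b r (d - lg n) : ℝ) : ℂ) =
      mTilde b k r + wTilde b k r n := by
  rw [Complex.ofReal_tsum, (expDecay_f b r).poisson k (lg n)]
  simp_rw [← wTerm_eq]
  rw [← (summable_wTerm b k r n).tsum_subtype_add_tsum_subtype_compl {0}, wTilde,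
    mTilde_eq_wTerm b k r n, tsum_singleton (0 : ℤ) (wTerm b k r n)]
  rfl

lemma isBigO_momentD (b r : ℕ) (hr : r ≤ b) (k : ℕ) (S : (n : ℕ) → List (Fin n))
    (hS : ∀ n, ∀ x, x ∈ S n) :
    (fun n : ℕ => (momentD b (S n) k r : ℂ) - (mTilde b k r + wTilde b k r n))
      =O[atTop] fun n : ℕ => (n : ℝ) ^ (-1 : ℝ) := by
  obtain ⟨K, hK⟩ := exists_abs_momentD_sub_tsum_le b r hr k
  refine IsBigO.of_bound K ?_
  filter_upwards [eventually_ge_atTop (b + 1)] with n hn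
  rw [← tsum_eq_mTilde_add_wTilde, ← Complex.ofReal_sub, Complex.norm_real, Real.norm_eq_abs,
    Real.rpow_neg_one, norm_inv, Real.norm_natCast, ← div_eq_mul_inv]
  exact hK n hn (S n) (hS n)

end AdaptiveSampling

end

/-! ### Assembly of the theorem -/

theorem mainTheorem3 (b : ℕ) :
    -- the moments are finite, and the Fourier series converge absolutely
    (∀ (n : ℕ), 1 ≤ n → ∀ S : List (Fin n), (∀ x, x ∈ S) → ∀ k : ℕ,
      Integrable (fun h => ((AdaptiveSampling.depth b S h : ℝ) - AdaptiveSampling.lg n) ^ k)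
        (AdaptiveSampling.hashMeasure n) ∧
      IntegrableOn (fun h => AdaptiveSampling.W b S h ^ k)
        {h | 0 < AdaptiveSampling.size b S h} (AdaptiveSampling.hashMeasure n)) ∧
    (∀ r ≤ b, ∀ k n : ℕ, 1 ≤ n →
      Summable fun l : {l : ℤ // l ≠ 0} => AdaptiveSampling.wTerm b k r n l) ∧
    -- the asymptotics, for arbitrary streams in which exactly `n` distinct keys occur
    (∃ δ : ℝ, 0 < δ ∧ ∀ S : (n : ℕ) → List (Fin n), (∀ n, ∀ x, x ∈ S n) →
      (∀ k : ℕ, ∀ r ≤ b,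
        (fun n : ℕ => (AdaptiveSampling.momentD b (S n) k r : ℂ) -
            (AdaptiveSampling.mTilde b k r + AdaptiveSampling.wTilde b k r n))
          =O[atTop] fun n : ℕ => (n : ℝ) ^ (-δ)) ∧
      ((fun n : ℕ => (AdaptiveSampling.momentW b (S n) 1 : ℂ) -
            (∑ r ∈ Finset.Icc 1 b, AdaptiveSampling.mTilde b 1 r +
              ∑ r ∈ Finset.Icc 1 b,
                ((AdaptiveSampling.probR b (S n) r * AdaptiveSampling.lg r : ℝ) : ℂ) +
              ∑ r ∈ Finset.Icc 1 b, AdaptiveSampling.wTilde b 1 r n))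
          =O[atTop] fun n : ℕ => (n : ℝ) ^ (-δ)) ∧
      ((fun n : ℕ => (AdaptiveSampling.momentW b (S n) 2 : ℂ) -
            (∑ r ∈ Finset.Icc 1 b, AdaptiveSampling.mTilde b 2 r +
              2 * ∑ r ∈ Finset.Icc 1 b,
                AdaptiveSampling.mTilde b 1 r * (AdaptiveSampling.lg r : ℂ) +
              ∑ r ∈ Finset.Icc 1 b,
                ((AdaptiveSampling.probR b (S n) r * AdaptiveSampling.lg r ^ 2 : ℝ) : ℂ) +
              ∑ r ∈ Finset.Icc 1 b, AdaptiveSampling.wTilde b 2 r n +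
              2 * ∑ r ∈ Finset.Icc 1 b,
                AdaptiveSampling.wTilde b 1 r n * (AdaptiveSampling.lg r : ℂ)))
          =O[atTop] fun n : ℕ => (n : ℝ) ^ (-δ))) ∧
    -- the explicit formulas for `k = 1`
    (∀ r, 1 ≤ r → r ≤ b →
      AdaptiveSampling.mTilde b 1 r =
        -(Complex.digamma r / (AdaptiveSampling.L ^ 2 * r)) +
          ∑ k ∈ Finset.range (b - r + 1),
            (Complex.digamma ((r : ℂ) + k) - AdaptiveSampling.L) * (2 : ℂ)⁻¹ ^ (r + k) *
              Complex.Gamma ((r : ℂ) + k) /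
                (AdaptiveSampling.L ^ 2 * Complex.Gamma ((r : ℂ) + 1) *
                  Complex.Gamma ((k : ℂ) + 1))) ∧
    (AdaptiveSampling.mTilde b 1 0 =
      1 / 2 + (Real.eulerMascheroniConstant : ℂ) / AdaptiveSampling.L +
        ∑ k ∈ Finset.Icc 1 b,
          (Complex.digamma k - AdaptiveSampling.L) * (2 : ℂ)⁻¹ ^ k /
            (k * AdaptiveSampling.L ^ 2)) ∧
    (∀ r, 1 ≤ r → r ≤ b → ∀ n : ℕ, 1 ≤ n →
      HasSum
        (fun l : {l : ℤ // l ≠ 0} =>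
          (-(Complex.digamma ((r : ℂ) + AdaptiveSampling.chi l) *
                Complex.Gamma ((r : ℂ) + AdaptiveSampling.chi l) /
              (AdaptiveSampling.L ^ 2 * Complex.Gamma ((r : ℂ) + 1))) +
            ∑ k ∈ Finset.range (b - r + 1),
              (Complex.digamma ((r : ℂ) + k + AdaptiveSampling.chi l) - AdaptiveSampling.L) *
                (2 : ℂ)⁻¹ ^ (r + k) * Complex.Gamma ((r : ℂ) + k + AdaptiveSampling.chi l) /
                  (AdaptiveSampling.L ^ 2 * Complex.Gamma ((r : ℂ) + 1) *
                    Complex.Gamma ((k : ℂ) + 1))) *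
          AdaptiveSampling.wave l n)
        (AdaptiveSampling.wTilde b 1 r n)) ∧
    (∀ n : ℕ, 1 ≤ n →
      HasSum
        (fun l : {l : ℤ // l ≠ 0} =>
          (-(Complex.digamma (AdaptiveSampling.chi l) * Complex.Gamma (AdaptiveSampling.chi l) /
              AdaptiveSampling.L ^ 2) +
            ∑ k ∈ Finset.range (b + 1),
              Complex.Gamma ((k : ℂ) + AdaptiveSampling.chi l) /
                  (AdaptiveSampling.L ^ 2 * (k.factorial : ℂ) * 2 ^ k) *
                (Complex.digamma ((k : ℂ) + AdaptiveSampling.chi l) - AdaptiveSampling.L)) *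
          AdaptiveSampling.wave l n)
        (AdaptiveSampling.wTilde b 1 0 n)) := by
  refine ⟨fun n hn S hS k => ⟨AdaptiveSampling.integrable_depth_sub_pow b S hS _ k,
      AdaptiveSampling.integrableOn_W_pow b hn S hS k⟩,
    fun r _ k n _ => (AdaptiveSampling.summable_wTerm b k r n).subtype _,
    ⟨1, one_pos, fun S hS => ⟨fun k r hr => AdaptiveSampling.isBigO_momentD b r hr k S hS, ?_, ?_⟩⟩,
    fun r hr _ => AdaptiveSampling.mTilde_one_pos b hr, AdaptiveSampling.mTilde_one_zero b,
    fun r hr _ n _ => ?_, fun n _ => ?_⟩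
  -- The terms with `p(r, ·)` occur exactly in the moments of `W` and cancel, so only the errors for
  -- `D` remain.
  · refine (IsBigO.sum (s := Finset.Icc 1 b) fun r hr =>
      AdaptiveSampling.isBigO_momentD b r (Finset.mem_Icc.1 hr).2 1 S hS).congr' ?_ EventuallyEq.rfl
    filter_upwards [eventually_ge_atTop 1] with n hn
    rw [AdaptiveSampling.momentW_one b hn (S n) (hS n), Finset.sum_apply, Complex.ofReal_sum,
      ← Finset.sum_add_distrib, ← Finset.sum_add_distrib, ← Finset.sum_sub_distrib]
    refine Finset.sum_congr rfl fun r _ => ?_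
    push_cast
    ring
  -- From the square of `(D - lg n) + lg r`: the error for `k = 2` plus `2 lg r` times the error for
  -- `k = 1`.
  · refine (IsBigO.sum (s := Finset.Icc 1 b) fun r hr =>
      (AdaptiveSampling.isBigO_momentD b r (Finset.mem_Icc.1 hr).2 2 S hS).add
        ((AdaptiveSampling.isBigO_momentD b r (Finset.mem_Icc.1 hr).2 1 S hS).const_mul_left
          (2 * (AdaptiveSampling.lg r : ℂ)))).congr' ?_ EventuallyEq.rfl
    filter_upwards [eventually_ge_atTop 1] with n hn
    rw [AdaptiveSampling.momentW_two b hn (S n) (hS n), Finset.sum_apply, Complex.ofReal_sum,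
      Finset.mul_sum, Finset.mul_sum, ← Finset.sum_add_distrib, ← Finset.sum_add_distrib,
      ← Finset.sum_add_distrib, ← Finset.sum_add_distrib, ← Finset.sum_sub_distrib]
    refine Finset.sum_congr rfl fun r _ => ?_
    push_cast
    ring
  · refine (((AdaptiveSampling.summable_wTerm b 1 r n).subtype {l | l ≠ 0}).hasSum).congr_fun
      fun l => ?_
    exact (AdaptiveSampling.wTerm_one_pos b hr n l.1).symm
  · refine (((AdaptiveSampling.summable_wTerm b 1 0 n).subtype {l | l ≠ 0}).hasSum).congr_fun
      fun l => ?_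
    exact (AdaptiveSampling.wTerm_one_zero b n l.2).symm
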